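/- **Theorem (complexity of T-BUDS).** Let $G=(V,E)$ be a finite simple undirected graph with $|V|\ge 2$, real node centralities $C[v]$, real edge importances $C(u,v)$, and a real utility threshold $\tau$. Let $F$ be the edge set of the two-hop graph of $G$, i.e. the set of pairs $\{a,c\}$ of distinct nodes that have a common neighbour $b$ ($\{a,b\},\{b,c\}\in E$). T-BUDS is the following algorithm. 1. *Two-hop MST.* Run Prim's algorithm on $(V,F)$ with weights $C[u]+C[v]$ from an arbitrary start node $s$, with a priority queue $Q$ holding all nodes: after deleting a node $v$ of minimum key, for every $w\in N(N(v))\setminus\{v\}$ that is still in $Q$ and has $key[w]>C[v]+C[w]$, set $key[w]=C[v]+C[w]$ and $parent[w]=v$. Let $H$ be the list of all pairs $(v,parent[v])$ with $parent[v]\ne$ Null, sorted by weight (a spanning forest if $(V,F)$ is disconnected). 2. *Binary search* for the largest $t$ such that the partition $\mathcal V_t$ of $V$, obtained from singletons by merging the supernodes of the two nodes of each of the first $t$ pairs of $H$, has utility at least $\tau$. In every round the partition is rebuilt from singletons with union-find (union by rank, path compression), and its utility is computed: for each supernode $S_i$ one scans the neighbours of its members, collecting in two maps the number $count[S_j]$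 and the total importance $sum[S_j]$ of the edges between $S_i$ and $S_j$ (each edge inside $S_i$ being counted once). Starting from $1$, one subtracts $\min(\mathrm{Sedge},\mathrm{nSedge})$ for every pair $i\le j$ with $count[S_j]\ge 1$, where $\mathrm{nSedge}=sum[S_j]$, and $\mathrm{Sedge}=\frac{|S_i||S_j|-count[S_j]}{\binom{|V|}{2}-|E|}$ if $i\neq j$, $\mathrm{Sedge}=\frac{\binom{|S_i|}{2}-count[S_j]}{\binom{|V|}{2}-|E|}$ if $i=j$ (a quotient with denominator $0$ is read as $0$). 3. Rebuild $\mathcal V_t$ for the $t$ found and, by the same scan, output a superedge $(S_i,S_j)$ for each pair with $\mathrm{Sedge}\le\mathrm{nSedge}$. Time is counted in steps of a random access machine with integer and real cells: a memory or input access, an output, a loop test, or a bounded block of arithmetic takes one step; a loop over $N(v)$, or over the set $N(N(v))\setminus\{v\}$, takes one step per element besides the cost of its body; and a find or merge operation of union-find (amortized cost $O(\lg^*|V|)$) is charged as one step. Priority queue operations and sorting are not primitive: the queue is a binary tournament tree stored in an array, and sorting is done with this queue. Working space is the number of memory cells used, apart from the read-only input, the write-only output and a fixed number of registers. Then there is an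 absolute constant $c>0$ such that, for all such inputs, T-BUDS terminates after at most $c\,(|F|+|V|)\cdot\lg|V|$ steps and uses at most $c\,|V|$ cells of working space, where $\lg=\log_2$. -/

import Mathlib

/-! ## The two-hop graph -/

/-- The two-hop graph of `G`: two distinct nodes are joined when they have a common neighbour. -/
def twoHopGraph {V : Type*} (G : SimpleGraph V) : SimpleGraph V where
  Adj a c := a ≠ c ∧ ∃ b, G.Adj a b ∧ G.Adj b c
  symm := ⟨fun _ _ h => ⟨h.1.symm, h.2.imp fun _ hb => ⟨hb.2.symm, hb.1.symm⟩⟩⟩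
  loopless := ⟨fun _ h => h.1 rfl⟩

namespace TBUDS

/-! ## The machine

A random access machine with natural number cells and real number cells (the latter may hold
`+∞`), organised in finitely many named arrays.  All cells are `0` at the start.  Programs are
written in a state monad; local variables of a program are its registers (a bounded number of
scalars).  Every primitive (memory access, input access, output, test of a loop, arithmetic block
of bounded size) takes one step. -/

/-- Names of the arrays of natural numbers. -/
inductive NArr where
  | parent | tree | H | uf | rank | head | next | size | count | keys
  deriving DecidableEq

/-- Names of the arrays of real numbers. -/
inductive RArr where
  | key | sum
  deriving DecidableEq

/-- State of the machine.  `cells` is the set of all memory cells that have been read or written so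
far.  `out` is a write-only output tape.  `ok` becomes `false` when a loop is cut off. -/
structure State (R : Type) where
  nat : NArr → ℕ → ℕ
  real : RArr → ℕ → WithTop R
  out : List (ℕ × ℕ)
  cells : Finset ((NArr ⊕ RArr) × ℕ)
  time : ℕ
  ok : Bool

/-- The state in which a computation starts. -/
def State.init (R : Type) [Zero R] : State R where
  nat := fun _ _ => 0
  real := fun _ _ => 0
  out := []
  cells := ∅
  time := 0
  ok := true

/-- Working space: the number of memory cells used. -/
def State.space {R : Type} (s : State R) : ℕ := s.cells.card

/-- Programs with result in `α`. -/
abbrev M (R : Type) (α : Type) := StateM (State R) α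

section Machine

variable {R : Type} {α σ : Type}

/-- Spend one step. -/
def tick : M R Unit := modify fun s => { s with time := s.time + 1 }

/-- A block of register arithmetic of bounded size, or the reading of one input item. -/
def op (x : α) : M R α := do
  tick
  pure x

/-- Read a natural number cell. -/
def rd (a : NArr) (i : ℕ) : M R ℕ := do
  tick
  modify fun s => { s with cells := insert (Sum.inl a, i) s.cells }
  let s ← get
  pure (s.nat a i)

/-- Write a natural number cell. -/
def wr (a : NArr) (i x : ℕ) : M R Unit := do
  tick
  modify fun s => { s with
    cells := insert (Sum.inl a, i) s.cells
    nat := fun b j => if b = a ∧ j = i then x else s.nat b j }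

/-- Read a real number cell. -/
def rdR (a : RArr) (i : ℕ) : M R (WithTop R) := do
  tick
  modify fun s => { s with cells := insert (Sum.inr a, i) s.cells }
  let s ← get
  pure (s.real a i)

/-- Write a real number cell. -/
def wrR (a : RArr) (i : ℕ) (x : WithTop R) : M R Unit := do
  tick
  modify fun s => { s with
    cells := insert (Sum.inr a, i) s.cells
    real := fun b j => if b = a ∧ j = i then x else s.real b j }

/-- Append a pair to the output tape. -/
def emit (p : ℕ × ℕ) : M R Unit := do
  tick
  modify fun s => { s with out := s.out ++ [p] }

/-- `for x in l do body`, updating a register `r`; one step per test of the loop. -/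
def forLoop : List α → σ → (α → σ → M R σ) → M R σ
  | [], r, _ => do
      tick
      pure r
  | x :: l, r, body => do
      tick
      let r' ← body x r
      forLoop l r' body

/-- `while cond do body`, updating a register `r`; one step per test of the loop.  A loop that has
not stopped by itself after `fuel` rounds is cut off, and this is recorded in `ok`. -/
def whileLoop : ℕ → (σ → M R Bool) → (σ → M R σ) → σ → M R σ
  | 0, cond, _, r => do
      tick
      let b ← cond r
      if b then modify fun s => { s with ok := false }
      pure r
  | fuel + 1, cond, body, r => do
      tick
      let b ← cond r
      if b then
        let r' ← body r
        whileLoop fuel cond body r'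
      else
        pure r

/-- Run `m`, charging a single step for it; its memory usage is counted in full. -/
def unitCost (m : M R α) : M R α := fun s =>
  let p := m s
  (p.1, { p.2 with time := s.time + 1 })

end Machine

/-! ## The input

The input is read-only and does not count as working space.  A `for` loop over `N(v)`, or over
`N(N(v))` without `v`, takes one step per element of this set besides the cost of its body. -/

/-- An input of the algorithm: a simple graph `G` on `0, …, n - 1`, node centralities `C`, edge
importances `W`, a utility threshold `τ`, and the node `s` at which the computation of the spanning
tree starts. -/
structure Input (R : Type) where
  n : ℕ
  G : SimpleGraph (Fin n)
  C : Fin n → R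
  W : Fin n → Fin n → R
  τ : R
  s : Fin n

section Algorithm

variable {R : Type} [Field R] [LinearOrder R]

open Classical in
/-- The list of the neighbours of `v` in a graph on `0, …, n - 1`. -/
noncomputable def nbrList {n : ℕ} (G : SimpleGraph (Fin n)) (v : ℕ) : List ℕ :=
  (List.range n).filter fun w => ∃ (hv : v < n) (hw : w < n), G.Adj ⟨v, hv⟩ ⟨w, hw⟩

/-- The list `N(v)`. -/
noncomputable def Input.nbrs (I : Input R) (v : ℕ) : List ℕ := nbrList I.G v

/-- The list of the elements of `N(N(v))` other than `v`, each once. -/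
noncomputable def Input.hop2 (I : Input R) (v : ℕ) : List ℕ := nbrList (twoHopGraph I.G) v

/-- The centrality `C[v]`. -/
def Input.cent (I : Input R) (v : ℕ) : R := if hv : v < I.n then I.C ⟨v, hv⟩ else 0

/-- The importance `C(u, v)` of an edge. -/
def Input.weight (I : Input R) (u v : ℕ) : R :=
  if h : u < I.n ∧ v < I.n then I.W ⟨u, h.1⟩ ⟨v, h.2⟩ else 0

/-! ## Priority queue

A tournament tree: the nodes of the tree are `1, …, 2n - 1`, the children of `i < n` are `2i` and
`2i + 1`, and `n + v` is the leaf of `v`.  A node of the tree holds `v + 1` if `v` is an element of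
the queue with the least key below that node, and `0` if there is none. -/

/-- The winner of two entries of the tree. -/
def winner (x y : ℕ) : M R ℕ := do
  if x = 0 then op y
  else if y = 0 then op x
  else
    let kx ← rdR .key (x - 1)
    let ky ← rdR .key (y - 1)
    op (if kx ≤ ky then x else y)

/-- Recompute the entries on the path from tree node `i` to the root. -/
def climb (fuel i : ℕ) : M R Unit := do
  let _ ← whileLoop fuel (fun i => op (decide (1 < i)))
    (fun i => do
      let p ← op (i / 2)
      let x ← rd .tree (2 * p)
      let y ← rd .tree (2 * p + 1)
      let z ← winner x y
      wr .tree p z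
      pure p) i
  pure ()

/-- Insert `v`, whose key is already in place. -/
def qInsert (I : Input R) (fuel v : ℕ) : M R Unit := do
  wr .tree (I.n + v) (v + 1)
  climb fuel (I.n + v)

/-- Change the key of the element `v`. -/
def qSetKey (I : Input R) (fuel v : ℕ) (k : WithTop R) : M R Unit := do
  wrR .key v k
  climb fuel (I.n + v)

/-- Is the queue nonempty? -/
def qNonempty : M R Bool := do
  let r ← rd .tree 1
  op (decide (r ≠ 0))

/-- Is `v` in the queue? -/
def qMem (I : Input R) (v : ℕ) : M R Bool := do
  let x ← rd .tree (I.n + v)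
  op (decide (x ≠ 0))

/-- Remove and return an element with the least key. -/
def qDelMin (I : Input R) (fuel : ℕ) : M R ℕ := do
  let r ← rd .tree 1
  let v ← op (r - 1)
  wr .tree (I.n + v) 0
  climb fuel (I.n + v)
  pure v

/-! ## The sorted edge list of a minimum spanning tree of the two-hop graph

Prim's algorithm.  `parent[v]` is `0` for `Null` and `p + 1` for the node `p`.  Afterwards
`key[v] = C[v] + C[parent[v]]` for every `v` with a parent, and the tree edges `(v, parent[v])` are
sorted by this weight with the help of the queue: `H[0], H[1], …` are the nodes `v` in this order.
(If the two-hop graph is not connected, the result is a minimum spanning forest.)  The number of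
edges is returned. -/

/-- The edges of the minimum spanning tree, in the array `parent`. -/
noncomputable def prim (I : Input R) (fuel : ℕ) : M R Unit := do
  forLoop (List.range (2 * I.n)) () fun i _ => wr .tree i 0
  wrR .key I.s 0
  wr .parent I.s 0
  qInsert I fuel I.s
  forLoop (List.range I.n) () fun v _ => do
    if v ≠ I.s then
      wrR .key v ⊤
      wr .parent v 0
      qInsert I fuel v
  whileLoop fuel (fun _ => qNonempty)
    (fun _ => do
      let v ← qDelMin I fuel
      forLoop (I.hop2 v) () fun w _ => do
        let inQ ← qMem I w
        if inQ then
          let k ← rdR .key w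
          let cv ← op (I.cent v)
          let cw ← op (I.cent w)
          let c ← op (cv + cw)
          if (c : WithTop R) < k then
            qSetKey I fuel w c
            wr .parent w (v + 1)) ()

/-- The sorted list `H` of the edges of the minimum spanning tree. -/
noncomputable def twoHopMST (I : Input R) (fuel : ℕ) : M R ℕ := do
  prim I fuel
  forLoop (List.range I.n) () fun v _ => do
    let p ← rd .parent v
    if p ≠ 0 then qInsert I fuel v
  whileLoop fuel (fun _ => qNonempty)
    (fun t => do
      let v ← qDelMin I fuel
      wr .H t v
      op (t + 1)) 0

/-! ## Supernodes: union-find with path compression and union by rank -/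

/-- The root of `x`, with path compression. -/
def find (fuel x : ℕ) : M R ℕ := do
  let r ← whileLoop fuel
    (fun y => do
      let p ← rd .uf y
      op (decide (p ≠ y)))
    (fun y => rd .uf y) x
  let _ ← whileLoop fuel (fun y => op (decide (y ≠ r)))
    (fun y => do
      let p ← rd .uf y
      wr .uf y r
      pure p) x
  pure r

/-- Merge the supernodes of `x` and `y`. -/
def unite (fuel x y : ℕ) : M R Unit := do
  let a ← find fuel x
  let b ← find fuel y
  if a ≠ b then
    let ra ← rd .rank a
    let rb ← rd .rank b
    if ra < rb then
      wr .uf a b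
    else
      wr .uf b a
      if ra = rb then wr .rank a (ra + 1)

/-- The find operation, as charged by the algorithm: one step. -/
def Find (fuel x : ℕ) : M R ℕ := unitCost (find fuel x)

/-- The merge operation, as charged by the algorithm: one step. -/
def Merge (fuel x y : ℕ) : M R Unit := unitCost (unite fuel x y)

/-- Start from the partition into singletons and process the first `t` pairs of `H`. -/
def mergeFirst (I : Input R) (fuel t : ℕ) : M R Unit := do
  forLoop (List.range I.n) () fun v _ => do
    wr .uf v v
    wr .rank v 0
  forLoop (List.range t) () fun i _ => do
    let v ← rd .H i
    let p ← rd .parent v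
    Merge fuel v (p - 1)

/-! ## Utility and superedges -/

/-- Compute the member lists of the supernodes: `head[i]` and `next[v]` hold `u + 1` for the node
`u` and `0` for the end of the list; `size[i]` is the number of members. -/
def members (I : Input R) (fuel : ℕ) : M R Unit := do
  forLoop (List.range I.n) () fun v _ => do
    wr .head v 0
    wr .size v 0
    wr .count v 0
  forLoop (List.range I.n) () fun v _ => do
    let r ← Find fuel v
    let h ← rd .head r
    wr .next v h
    wr .head r (v + 1)
    let k ← rd .size r
    wr .size r (k + 1)

/-- Collect `count` and `sum` for the supernode `i`; the supernodes `j` with `count[j] ≥ 1` are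
listed in `keys`, and their number is returned. -/
noncomputable def collect (I : Input R) (fuel i : ℕ) : M R ℕ := do
  let h ← rd .head i
  let p ← whileLoop fuel (fun p : ℕ × ℕ => op (decide (p.1 ≠ 0)))
    (fun p => do
      let u ← op (p.1 - 1)
      let k' ← forLoop (I.nbrs u) p.2 fun v k => do
        let j ← Find fuel v
        if i ≠ j ∨ (i = j ∧ u < v) then
          let c ← rd .count j
          let w ← op (I.weight u v)
          if 1 ≤ c then
            wr .count j (c + 1)
            let x ← rdR .sum j
            wrR .sum j (x + w)
            pure k
          else
            wr .count j 1
            wrR .sum j w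
            wr .keys k j
            op (k + 1)
        else pure k
      let u' ← rd .next u
      pure (u', k')) (h, 0)
  pure p.2

/-- Run through all pairs `i ≤ j` of supernodes joined by at least one edge, and call
`visit i j (Sedge i j) (nSedge i j)` on them, updating a register; `m` is the number of edges. -/
noncomputable def scanPairs (I : Input R) (fuel m : ℕ) (r : R)
    (visit : ℕ → ℕ → R → R → R → M R R) : M R R := do
  members I fuel
  forLoop (List.range I.n) r fun i r => do
    let si ← rd .size i
    if si = 0 then pure r
    else
      let nk ← collect I fuel i
      forLoop (List.range nk) r fun t r => do
        let j ← rd .keys t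
        let c ← rd .count j
        wr .count j 0
        if i ≤ j then
          let x ← rdR .sum j
          let ns ← op (x.untopD 0)
          let sj ← rd .size j
          let d ← op (((I.n * (I.n - 1) / 2 : ℕ) : R) - (m : R))
          let pairs ← op (if i ≠ j then si * sj else si * (si - 1) / 2)
          let se ← op (((pairs : R) - (c : R)) / d)
          visit i j se ns r
        else pure r

/-- The utility of the current partition into supernodes. -/
noncomputable def computeUtility (I : Input R) (fuel m : ℕ) : M R R :=
  scanPairs I fuel m 1 fun _ _ se ns r => op (if se ≤ ns then r - se else r - ns)

/-- Output the superedges of the current partition into supernodes. -/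
noncomputable def buildSuperEdges (I : Input R) (fuel m : ℕ) : M R Unit := do
  let _ ← scanPairs I fuel m 0 fun i j se ns r => do
    if se ≤ ns then emit (i, j)
    pure r
  pure ()

/-! ## T-BUDS -/

/-- The number of edges of the input graph. -/
noncomputable def countEdges (I : Input R) : M R ℕ :=
  forLoop (List.range I.n) 0 fun u m =>
    forLoop (I.nbrs u) m fun v m => op (if u < v then m + 1 else m)

/-- T-BUDS: binary search for the largest `t` such that the partition obtained from the first `t`
pairs of `H` has utility at least `τ`; the pairs `(lo, hi)` are the bounds `low` and `high + 1` of
the search.  The final partition is left in the union-find arrays, its superedges are the output. -/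
noncomputable def tbuds (I : Input R) (fuel : ℕ) : M R Unit := do
  let m ← countEdges I
  let h ← twoHopMST I fuel
  let p ← whileLoop fuel (fun p : ℕ × ℕ => op (decide (p.1 < p.2)))
    (fun p => do
      let mid ← op ((p.1 + p.2 - 1) / 2)
      mergeFirst I fuel (mid + 1)
      let u ← computeUtility I fuel m
      if I.τ ≤ u then op (mid + 1, p.2) else op (p.1, mid)) (0, h)
  mergeFirst I fuel p.1
  buildSuperEdges I fuel m

/-- The state in which T-BUDS ends on the input `I` when loops may run for `fuel` rounds. -/
noncomputable def run (I : Input R) (fuel : ℕ) : State R :=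
  (tbuds I fuel (State.init R)).2

/-- T-BUDS terminates on the input `I`, within `t` steps and with `k` cells of working space. -/
def RunsWithin (I : Input R) (t k : ℝ) : Prop :=
  ∃ fuel : ℕ, (run I fuel).ok = true ∧ ((run I fuel).time : ℝ) ≤ t ∧ ((run I fuel).space : ℝ) ≤ k

end Algorithm

end TBUDS

/-! The bounds do not depend on the correctness of the algorithm, so the proof never shows that keys
are minimal, that `H` is a spanning forest or that a utility is right. It tracks only what controls
time, memory and termination: stored numbers stay in range, loops stop before the fuel runs out, and
the clock stays within a budget. A weakest-precondition calculus `wp` for the machine carries these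
invariants through the program.

Space: by `Inv`, all twelve arrays are addressed below `2n`, hence at most `24n` cells are used.

Spanning tree (`wp_twoHopMST`): a climb in the tournament tree takes O(log n) steps. Each deletion
removes one live leaf, and a deleted node `v` triggers at most one key change per element of its
two-hop neighbourhood. The sizes of these neighbourhoods add up to `2|F|`, which gives O((|F| + n)
log n) steps.

Binary search (`wp_tbuds`): there are O(log n) rounds. Rebuilding and scanning a partition costs O(n
+ |E|), since the member lists of the supernodes are disjoint (`wp_scanPairs`). Find and merge are
charged one step each, but they must still be shown to terminate; ranks that increase along the
pointers do this.

It remains to bound |E| by |F| and n (`sum_degree_le_sum_degree_twoHopGraph`). If `v` is a neighbour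
of `u`, every neighbour of `v` except `u` is a two-hop neighbour of `u`, so deg v ≤ deg_F u + 1.
Averaging over the neighbours of `u` and summing over `u` gives at most 2|F| + n. The same sum
collects deg v / deg u + deg u / deg v ≥ 2 from every edge, hence is at least 2|E|. -/

namespace TBUDS

/-! ## Weakest preconditions -/

section Machine

variable {R : Type} {α β σ : Type}

/-- Running `m` in the state `s` ends with a result and a state satisfying `Q`. -/
def wp (m : M R α) (Q : α → State R → Prop) (s : State R) : Prop := Q (m s).1 (m s).2

/-- The effect of a step on the clock. -/
def State.ticked (s : State R) : State R := { s with time := s.time + 1 }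

/-- The effect of a memory access on the clock and on the set of used cells. -/
def State.touch (s : State R) (c : (NArr ⊕ RArr) × ℕ) : State R :=
  { s with time := s.time + 1, cells := insert c s.cells }

/-- The effect of writing a natural number cell. -/
def State.setNat (s : State R) (a : NArr) (i x : ℕ) : State R :=
  { s with
    time := s.time + 1
    cells := insert (Sum.inl a, i) s.cells
    nat := fun b j => if b = a ∧ j = i then x else s.nat b j }

/-- The effect of writing a real number cell. -/
def State.setReal (s : State R) (a : RArr) (i : ℕ) (x : WithTop R) : State R :=
  { s with
    time := s.time + 1
    cells := insert (Sum.inr a, i) s.cells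
    real := fun b j => if b = a ∧ j = i then x else s.real b j }

/-- The same state with another clock. -/
def State.atTime (s : State R) (t : ℕ) : State R := { s with time := t }

section Projections

variable (s : State R) (c : (NArr ⊕ RArr) × ℕ) (a : NArr) (b : RArr) (i x t : ℕ) (y : WithTop R)

@[simp] theorem State.ticked_nat : s.ticked.nat = s.nat := rfl
@[simp] theorem State.ticked_time : s.ticked.time = s.time + 1 := rfl
@[simp] theorem State.touch_nat : (s.touch c).nat = s.nat := rfl
@[simp] theorem State.touch_time : (s.touch c).time = s.time + 1 := rfl
@[simp] theorem State.setNat_time : (s.setNat a i x).time = s.time + 1 := rfl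
@[simp] theorem State.setReal_nat : (s.setReal b i y).nat = s.nat := rfl
@[simp] theorem State.setReal_time : (s.setReal b i y).time = s.time + 1 := rfl
@[simp] theorem State.atTime_nat : (s.atTime t).nat = s.nat := rfl

theorem State.setNat_nat_self :
    (s.setNat a i x).nat a = fun j => if j = i then x else s.nat a j := by
  funext j; simp [State.setNat]

theorem State.setNat_nat_of_ne {a' : NArr} (h : a' ≠ a) : (s.setNat a i x).nat a' = s.nat a' := by
  funext j; simp [State.setNat, h]

@[simp] theorem State.setNat_nat (a' : NArr) :
    (s.setNat a i x).nat a' = if a' = a then fun j => if j = i then x else s.nat a j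
      else s.nat a' := by
  split_ifs with h
  · subst h; exact s.setNat_nat_self a' i x
  · exact s.setNat_nat_of_ne a i x h

end Projections

theorem wp_mono {m : M R α} {P Q : α → State R → Prop} {s : State R} (h : wp m P s)
    (hPQ : ∀ a s', P a s' → Q a s') : wp m Q s := hPQ _ _ h

@[simp] theorem wp_pure (x : α) (Q : α → State R → Prop) (s : State R) :
    wp (pure x) Q s ↔ Q x s := Iff.rfl

@[simp] theorem wp_bind (m : M R α) (f : α → M R β) (Q : β → State R → Prop) (s : State R) :
    wp (m >>= f) Q s ↔ wp m (fun a s' => wp (f a) Q s') s := Iff.rfl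

@[simp] theorem wp_tick (Q : Unit → State R → Prop) (s : State R) :
    wp tick Q s ↔ Q () s.ticked := Iff.rfl

@[simp] theorem wp_op (x : α) (Q : α → State R → Prop) (s : State R) :
    wp (op x) Q s ↔ Q x s.ticked := Iff.rfl

@[simp] theorem wp_rd (a : NArr) (i : ℕ) (Q : ℕ → State R → Prop) (s : State R) :
    wp (rd a i) Q s ↔ Q (s.nat a i) (s.touch (Sum.inl a, i)) := Iff.rfl

@[simp] theorem wp_rdR (a : RArr) (i : ℕ) (Q : WithTop R → State R → Prop) (s : State R) :
    wp (rdR a i) Q s ↔ Q (s.real a i) (s.touch (Sum.inr a, i)) := Iff.rfl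

@[simp] theorem wp_wr (a : NArr) (i x : ℕ) (Q : Unit → State R → Prop) (s : State R) :
    wp (wr a i x) Q s ↔ Q () (s.setNat a i x) := Iff.rfl

@[simp] theorem wp_wrR (a : RArr) (i : ℕ) (x : WithTop R) (Q : Unit → State R → Prop)
    (s : State R) : wp (wrR a i x) Q s ↔ Q () (s.setReal a i x) := Iff.rfl

theorem wp_ite (c : Prop) [Decidable c] (m m' : M R α) (Q : α → State R → Prop) (s : State R) :
    wp (if c then m else m') Q s ↔ if c then wp m Q s else wp m' Q s := by
  split_ifs <;> rfl

/-- Only the clock is overridden: the cells used and the `ok` flag of the inner run remain, so the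
operations charged as one step still need a termination proof. -/
theorem wp_unitCost {m : M R α} {Q : α → State R → Prop} {s : State R}
    (h : wp m (fun a s' => Q a (s'.atTime (s.time + 1))) s) : wp (unitCost m) Q s := h

/-- A `for` loop keeps an invariant that may depend on the number of remaining rounds. -/
theorem wp_forLoop {body : α → σ → M R σ} {Q : σ → State R → Prop}
    (J : ℕ → σ → State R → Prop) {l : List α} {r : σ} {s : State R}
    (h0 : J l.length r s)
    (hstep : ∀ x ∈ l, ∀ k r s, J (k + 1) r s → wp (body x r) (J k) s.ticked)
    (hend : ∀ r s, J 0 r s → Q r s.ticked) : wp (forLoop l r body) Q s := by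
  induction l generalizing r s with
  | nil => exact hend r s h0
  | cons x l ih =>
    have h1 := hstep x (by simp) l.length r s h0
    change wp (do tick; let r' ← body x r; forLoop l r' body) Q s
    simp only [wp_bind, wp_tick]
    exact wp_mono h1 fun r' s' h' => ih h' fun y hy => hstep y (by simp [hy])

/-- A `for` loop over `a, …, a + m - 1` keeps an invariant that may depend on the position. -/
theorem wp_forLoop_range' {body : ℕ → σ → M R σ} {Q : σ → State R → Prop}
    (J : ℕ → σ → State R → Prop) {a m : ℕ} {r : σ} {s : State R} (h0 : J a r s)
    (hstep : ∀ k, k < a + m → ∀ r s, J k r s → wp (body k r) (J (k + 1)) s.ticked)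
    (hend : ∀ r s, J (a + m) r s → Q r s.ticked) :
    wp (forLoop (List.range' a m) r body) Q s := by
  induction m generalizing a r s with
  | zero => exact hend r s h0
  | succ m ih =>
    have h1 := hstep a (by omega) r s h0
    change wp (do tick; let r' ← body a r; forLoop (List.range' (a + 1) m) r' body) Q s
    simp only [wp_bind, wp_tick]
    exact wp_mono h1 fun r' s' h' => ih h' (fun k hk => hstep k (by omega))
      fun r s h => hend r s (by rwa [show a + (m + 1) = a + 1 + m by omega])

/-- A `for` loop over `0, …, m - 1` keeps an invariant that may depend on the position. -/
theorem wp_forLoop_range {body : ℕ → σ → M R σ} {Q : σ → State R → Prop}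
    (J : ℕ → σ → State R → Prop) {m : ℕ} {r : σ} {s : State R} (h0 : J 0 r s)
    (hstep : ∀ k, k < m → ∀ r s, J k r s → wp (body k r) (J (k + 1)) s.ticked)
    (hend : ∀ r s, J m r s → Q r s.ticked) : wp (forLoop (List.range m) r body) Q s := by
  rw [List.range_eq_range']
  exact wp_forLoop_range' J h0 (by simpa using hstep) (by simpa using hend)

/-- A `while` loop keeps an invariant that may depend on a bound for the number of remaining
rounds; it is not cut off when the fuel exceeds this bound. -/
theorem wp_whileLoop {cond : σ → M R Bool} {body : σ → M R σ} {Q : σ → State R → Prop}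
    (J : ℕ → σ → State R → Prop)
    (hstep : ∀ k r s, J k r s → wp (cond r)
      (fun b s' => if b then ∃ k' < k, wp (body r) (J k') s' else Q r s') s.ticked)
    {fuel k : ℕ} {r : σ} {s : State R} (hk : k ≤ fuel) (h0 : J k r s) :
    wp (whileLoop fuel cond body r) Q s := by
  induction fuel generalizing k r s with
  | zero =>
    change wp (do
      tick
      let b ← cond r
      if b then modify fun s => { s with ok := false }
      pure r) Q s
    simp only [wp_bind, wp_tick]
    refine wp_mono (hstep k r s h0) fun b s' h' => ?_
    cases b with
    -- Without fuel the bound `k` is `0`, and a further round would need some `k' < 0`.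
    | true => simp at h'; omega
    | false => simpa using h'
  | succ fuel ih =>
    change wp (do
      tick
      let b ← cond r
      if b then
        let r' ← body r
        whileLoop fuel cond body r'
      else
        pure r) Q s
    simp only [wp_bind, wp_tick]
    refine wp_mono (hstep k r s h0) fun b s' h' => ?_
    cases b with
    | true =>
      simp only [if_true] at h'
      obtain ⟨k', hk', h'⟩ := h'
      change wp (do let r' ← body r; whileLoop fuel cond body r') Q s'
      rw [wp_bind]
      exact wp_mono h' fun r' s'' h'' => ih (by omega) h''
    | false => simpa using h'

end Machine

/-! ## The basic invariant -/

section Invariant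

variable {R : Type} {n : ℕ} {s : State R}

/-- The numbers that may be stored in an array. -/
def Fits (n : ℕ) : NArr → ℕ → Prop
  -- Entries shifted by one, with `0` for "none", may equal `n`; plain nodes are below `n`; ranks,
  -- sizes and counts never serve as addresses.
  | .parent, x | .tree, x | .head, x | .next, x => x ≤ n
  | .H, x | .uf, x | .keys, x => x < n
  | .rank, _ | .size, _ | .count, _ => True

/-- No loop has been cut off, only cells with index less than `2n` have been used, and all stored
numbers are in their range. -/
structure Inv (n : ℕ) (s : State R) : Prop where
  ok : s.ok = true
  cells : ∀ c ∈ s.cells, c.2 < 2 * n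
  fits : ∀ a i, Fits n a (s.nat a i)

theorem Inv.ticked (h : Inv n s) : Inv n s.ticked := ⟨h.ok, h.cells, h.fits⟩

theorem Inv.atTime (h : Inv n s) (t : ℕ) : Inv n (s.atTime t) := ⟨h.ok, h.cells, h.fits⟩

theorem Inv.insert_cells {c : (NArr ⊕ RArr) × ℕ} (h : Inv n s) (hc : c.2 < 2 * n) :
    ∀ c' ∈ insert c s.cells, c'.2 < 2 * n := fun c' hc' => by
  rcases Finset.mem_insert.1 hc' with rfl | hc'
  · exact hc
  · exact h.cells c' hc'

theorem Inv.touch {c : (NArr ⊕ RArr) × ℕ} (h : Inv n s) (hc : c.2 < 2 * n) : Inv n (s.touch c) :=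
  ⟨h.ok, h.insert_cells hc, h.fits⟩

theorem Inv.setReal {a : RArr} {i : ℕ} {x : WithTop R} (h : Inv n s) (hi : i < 2 * n) :
    Inv n (s.setReal a i x) :=
  ⟨h.ok, h.insert_cells hi, h.fits⟩

theorem Inv.setNat {a : NArr} {i x : ℕ} (h : Inv n s) (hi : i < 2 * n) (hx : Fits n a x) :
    Inv n (s.setNat a i x) := by
  refine ⟨h.ok, h.insert_cells hi, fun b j => ?_⟩
  have := h.fits b j
  rw [State.setNat_nat]
  split_ifs with hb
  · subst hb
    dsimp only
    split_ifs <;> assumption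
  · exact this

/-- Positivity of `n` makes the initial content `0` of `H`, `uf` and `keys` a legal node. -/
theorem inv_initial [Zero R] (hn : 0 < n) : Inv n (State.init R) :=
  ⟨rfl, by simp [State.init], fun a i => by cases a <;> simp [State.init, Fits, hn]⟩

theorem Inv.parent_le (h : Inv n s) (i : ℕ) : s.nat .parent i ≤ n := h.fits .parent i
theorem Inv.tree_le (h : Inv n s) (i : ℕ) : s.nat .tree i ≤ n := h.fits .tree i
theorem Inv.head_le (h : Inv n s) (i : ℕ) : s.nat .head i ≤ n := h.fits .head i
theorem Inv.next_le (h : Inv n s) (i : ℕ) : s.nat .next i ≤ n := h.fits .next i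
theorem Inv.H_lt (h : Inv n s) (i : ℕ) : s.nat .H i < n := h.fits .H i
theorem Inv.uf_lt (h : Inv n s) (i : ℕ) : s.nat .uf i < n := h.fits .uf i
theorem Inv.keys_lt (h : Inv n s) (i : ℕ) : s.nat .keys i < n := h.fits .keys i

/-- The working space is at most `24n`. -/
theorem Inv.space_le (h : Inv n s) : s.space ≤ 24 * n := by
  classical
  let A : Finset (NArr ⊕ RArr) := ([NArr.parent, .tree, .H, .uf, .rank, .head, .next, .size,
    .count, .keys].toFinset.image Sum.inl) ∪ ([RArr.key, .sum].toFinset.image Sum.inr)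
  have hA : ∀ a, a ∈ A := by
    rintro (a | a) <;> cases a <;> simp [A]
  have hcard : A.card ≤ 12 := by decide
  have hsub : s.cells ⊆ A ×ˢ Finset.range (2 * n) := fun c hc => by
    simp [hA, h.cells c hc]
  calc s.space ≤ (A ×ˢ Finset.range (2 * n)).card := Finset.card_le_card hsub
    _ = A.card * (2 * n) := by simp
    _ ≤ 12 * (2 * n) := Nat.mul_le_mul_right _ hcard
    _ = 24 * n := by ring

end Invariant

/-! ## The tournament tree -/

section Tree

variable {R : Type} [LinearOrder R] {n : ℕ}

/-- Every leaf holds its element or nothing, and every inner node with the possible exception of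
`e` holds one of the entries of its children. -/
structure TreeOK (n e : ℕ) (T : ℕ → ℕ) : Prop where
  leaf : ∀ v < n, T (n + v) = 0 ∨ T (n + v) = v + 1
  inner : ∀ p, 1 ≤ p → p < n → p ≠ e → T p = T (2 * p) ∨ T p = T (2 * p + 1)

/-- A nonempty tournament tree has an element of the queue at its root. -/
theorem TreeOK.root {T : ℕ → ℕ} (h : TreeOK n 0 T) (hn : 0 < n) (h1 : T 1 ≠ 0) :
    ∃ v < n, T 1 = v + 1 ∧ T (n + v) = v + 1 := by
  -- Descend from `p` to a child with the same entry; indices grow, so `2 * n - p` decreases until a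
  -- leaf is reached.
  have key : ∀ m p, 1 ≤ p → p < 2 * n → 2 * n - p ≤ m → T p ≠ 0 →
      ∃ v < n, T p = v + 1 ∧ T (n + v) = v + 1 := by
    intro m
    induction m with
    | zero => intro p _ _ _; omega
    | succ m ih =>
      intro p hp hp2 hm h0
      by_cases hpn : p < n
      · rcases h.inner p hp hpn (by omega) with hc | hc
        · rw [hc] at h0 ⊢
          exact ih _ (by omega) (by omega) (by omega) h0
        · rw [hc] at h0 ⊢
          exact ih _ (by omega) (by omega) (by omega) h0
      · have := h.leaf (p - n) (by omega)
        rw [show n + (p - n) = p by omega] at this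
        rcases this with h' | h'
        · exact absurd h' h0
        · exact ⟨p - n, by omega, h', by rwa [show n + (p - n) = p by omega]⟩
  exact key _ 1 le_rfl (by omega) le_rfl h1

/-- Changing a leaf leaves only its parent in need of repair. -/
theorem TreeOK.set_leaf {T : ℕ → ℕ} (h : TreeOK n 0 T) {v x : ℕ}
    (hx : x = 0 ∨ x = v + 1) :
    TreeOK n ((n + v) / 2) (fun j => if j = n + v then x else T j) := by
  refine ⟨fun w hw => ?_, fun p hp hpn hpe => ?_⟩
  · have := h.leaf w hw
    grind
  · have := h.inner p hp hpn (by omega)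
    grind

/-- Recomputing an inner node leaves only its parent in need of repair. -/
theorem TreeOK.set_inner {T : ℕ → ℕ} {p x : ℕ} (h : TreeOK n p T) (hpn : p < n)
    (hx : x = T (2 * p) ∨ x = T (2 * p + 1)) :
    TreeOK n (p / 2) (fun j => if j = p then x else T j) := by
  refine ⟨fun w hw => ?_, fun q hq hqn hqe => ?_⟩
  · have := h.leaf w hw
    grind
  · have := h.inner q hq hqn
    grind

/-- Exception `0` means no exception, as inner nodes start at `1`. Keys do not occur in `TreeOK`, so
a key change does not damage it. -/
theorem TreeOK.weaken {T : ℕ → ℕ} (h : TreeOK n 0 T) (e : ℕ) : TreeOK n e T :=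
  ⟨h.leaf, fun p hp hpn _ => h.inner p hp hpn (by omega)⟩

/-- A queue operation: the arrays other than `tree` and the leaves of the tree are unchanged. -/
structure QFrame (n : ℕ) (s s' : State R) : Prop where
  other : ∀ a, a ≠ .tree → s'.nat a = s.nat a
  leaves : ∀ v, s'.nat .tree (n + v) = s.nat .tree (n + v)

theorem wp_winner {x y : ℕ} {s : State R} (hi : Inv n s) (hx : x ≤ n) (hy : y ≤ n) :
    wp (winner x y) (fun z s' => (z = x ∨ z = y) ∧ Inv n s' ∧ s'.nat = s.nat ∧
      s'.time ≤ s.time + 3) s := by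
  unfold winner
  simp only [wp_ite, wp_bind, wp_op, wp_rdR]
  split_ifs with h1 h2
  · exact ⟨by simp, hi.ticked, rfl, by simp⟩
  · exact ⟨by simp, hi.ticked, rfl, by simp⟩
  all_goals
    refine ⟨by tauto, ((hi.touch ?_).touch ?_).ticked, rfl, by simp⟩ <;> dsimp only <;> omega

/-- Only the parent of `i` may be inconsistent; each round repairs it and passes the defect one
level up, until it disappears at index `0`. A level costs at most `9` steps and the final test `2`.
-/
theorem wp_climb {fuel L i : ℕ} {s : State R} (hi : Inv n s) (hT : TreeOK n (i / 2) (s.nat .tree))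
    (h1 : 1 ≤ i) (hin : i < 2 * n) (hL : i < 2 ^ (L + 1)) (hfuel : L ≤ fuel) :
    wp (climb fuel i) (fun _ s' => Inv n s' ∧ TreeOK n 0 (s'.nat .tree) ∧ QFrame n s s' ∧
      s'.time ≤ s.time + (9 * L + 2)) s := by
  unfold climb
  simp only [wp_bind, wp_pure]
  refine wp_whileLoop (fun m i s' => Inv n s' ∧ TreeOK n (i / 2) (s'.nat .tree) ∧ QFrame n s s' ∧
      1 ≤ i ∧ i < 2 * n ∧ i < 2 ^ (m + 1) ∧ s'.time + 9 * m ≤ s.time + 9 * L) ?_ hfuel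
      ⟨hi, hT, ⟨fun _ _ => rfl, fun _ => rfl⟩, h1, hin, hL, le_rfl⟩
  rintro k i s' ⟨hi, hT, hF, h1, hin, hk, ht⟩
  simp only [wp_op, decide_eq_true_eq]
  split_ifs with hlt
  · obtain ⟨k, rfl⟩ : ∃ m, k = m + 1 := ⟨k - 1, by
      rcases k with _ | k
      · norm_num at hk; omega
      · rfl⟩
    refine ⟨k, by omega, ?_⟩
    simp only [wp_bind, wp_op, wp_rd, wp_wr, wp_pure, State.touch_nat, State.ticked_nat]
    have hi' := ((hi.ticked.ticked.ticked.touch (c := (Sum.inl .tree, 2 * (i / 2)))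
      (by dsimp only; omega)).touch (c := (Sum.inl .tree, 2 * (i / 2) + 1))
      (by dsimp only; omega))
    refine wp_mono (wp_winner hi' (hi.tree_le _) (hi.tree_le _)) ?_
    rintro z s'' ⟨hz, hi'', hn, ht''⟩
    simp only [State.touch_nat, State.ticked_nat, State.touch_time, State.ticked_time] at hn ht''
    have hzn : z ≤ n := by
      have h1 := hi.tree_le (2 * (i / 2))
      have h2 := hi.tree_le (2 * (i / 2) + 1)
      rcases hz with rfl | rfl <;> assumption
    refine ⟨hi''.setNat (by omega) hzn, ?_, ⟨fun a ha => ?_, fun v => ?_⟩, by omega, by omega,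
      ?_, ?_⟩
    · rw [State.setNat_nat_self, hn]
      exact hT.set_inner (by omega) hz
    · rw [State.setNat_nat_of_ne _ _ _ _ ha, hn, hF.other a ha]
    · rw [State.setNat_nat_self, hn]
      dsimp only
      rw [if_neg (by omega), hF.leaves]
    · rw [pow_succ] at hk; omega
    · simp only [State.setNat_time]; omega
  · have : i / 2 = 0 := by omega
    rw [this] at hT
    exact ⟨hi.ticked.ticked, hT, ⟨hF.other, hF.leaves⟩, by simp; omega⟩

/-- Setting a leaf and repairing the tree. -/
theorem wp_set_leaf_climb {fuel L v x : ℕ} {s : State R} (hi : Inv n s)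
    (hT : TreeOK n 0 (s.nat .tree)) (hv : v < n) (hx : x = 0 ∨ x = v + 1) (hL : n ≤ 2 ^ L)
    (hfuel : L ≤ fuel) :
    wp (climb fuel (n + v)) (fun _ s' => Inv n s' ∧ TreeOK n 0 (s'.nat .tree) ∧
      (∀ a, a ≠ .tree → s'.nat a = s.nat a) ∧
      (∀ w, s'.nat .tree (n + w) = if w = v then x else s.nat .tree (n + w)) ∧
      s'.time ≤ s.time + (9 * L + 3)) (s.setNat .tree (n + v) x) := by
  refine wp_mono (wp_climb (L := L) (hi.setNat (by omega) (show x ≤ n by omega)) ?_ (by omega)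
    (by omega) (by rw [pow_succ]; omega) hfuel) ?_
  · rw [State.setNat_nat_self]
    exact hT.set_leaf hx
  · rintro _ s' ⟨hi', hT', hF, ht⟩
    refine ⟨hi', hT', fun a ha => ?_, fun w => ?_, ?_⟩
    · rw [hF.other a ha, State.setNat_nat_of_ne _ _ _ _ ha]
    · rw [hF.leaves, State.setNat_nat_self]
      simp
    · simp only [State.setNat_time] at ht; omega

theorem wp_qInsert {I : Input R} {fuel L v : ℕ} {s : State R} (hi : Inv I.n s)
    (hT : TreeOK I.n 0 (s.nat .tree)) (hv : v < I.n) (hL : I.n ≤ 2 ^ L) (hfuel : L ≤ fuel) :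
    wp (qInsert I fuel v) (fun _ s' => Inv I.n s' ∧ TreeOK I.n 0 (s'.nat .tree) ∧
      (∀ a, a ≠ .tree → s'.nat a = s.nat a) ∧ s'.time ≤ s.time + (9 * L + 3)) s := by
  unfold qInsert
  simp only [wp_bind, wp_wr]
  exact wp_mono (wp_set_leaf_climb hi hT hv (.inr rfl) hL hfuel)
    fun _ s' h => ⟨h.1, h.2.1, h.2.2.1, h.2.2.2.2⟩

theorem wp_qSetKey {I : Input R} {fuel L v : ℕ} {k : WithTop R} {s : State R} (hi : Inv I.n s)
    (hT : TreeOK I.n 0 (s.nat .tree)) (hv : v < I.n) (hL : I.n ≤ 2 ^ L) (hfuel : L ≤ fuel) :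
    wp (qSetKey I fuel v k) (fun _ s' => Inv I.n s' ∧ TreeOK I.n 0 (s'.nat .tree) ∧
      QFrame I.n s s' ∧ s'.time ≤ s.time + (9 * L + 3)) s := by
  unfold qSetKey
  simp only [wp_bind, wp_wrR]
  refine wp_mono (wp_climb (L := L) (hi.setReal (by omega)) (hT.weaken _) (by omega) (by omega)
    (by rw [pow_succ]; omega) hfuel) ?_
  rintro _ s' ⟨hi', hT', hF, ht⟩
  refine ⟨hi', hT', ⟨hF.other, hF.leaves⟩, ?_⟩
  simp only [State.setReal_time] at ht; omega

/-- The sum of the weights of the elements of the queue. -/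
def liveSum (n : ℕ) (g : ℕ → ℕ) (T : ℕ → ℕ) : ℕ :=
  ∑ v ∈ Finset.range n, if T (n + v) = 0 then 0 else g v

theorem liveSum_le (g : ℕ → ℕ) (T : ℕ → ℕ) : liveSum n g T ≤ ∑ v ∈ Finset.range n, g v :=
  Finset.sum_le_sum fun v _ => by split_ifs <;> simp

theorem liveSum_congr {g : ℕ → ℕ} {T T' : ℕ → ℕ} (h : ∀ v, T' (n + v) = T (n + v)) :
    liveSum n g T' = liveSum n g T := by
  simp [liveSum, h]

theorem liveSum_remove {g : ℕ → ℕ} {T T' : ℕ → ℕ} {v : ℕ} (hv : v < n) (hT : T (n + v) ≠ 0)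
    (h : ∀ w, T' (n + w) = if w = v then 0 else T (n + w)) :
    liveSum n g T' + g v = liveSum n g T := by
  unfold liveSum
  rw [← Finset.add_sum_erase _ _ (Finset.mem_range.2 hv),
    ← Finset.add_sum_erase (a := v) _ _ (Finset.mem_range.2 hv)]
  simp only [h, if_true, if_neg hT]
  rw [zero_add, add_comm]
  congr 1
  exact Finset.sum_congr rfl fun w hw => by simp [Finset.ne_of_mem_erase hw]

/-- Emptying the queue, when the treatment `body` of a deleted element keeps the queue and an
invariant `K`, and takes at most `g v` steps for the element `v`. -/
theorem wp_drain {I : Input R} {σ : Type} {fuel L : ℕ} {body : ℕ → σ → M R σ} {g : ℕ → ℕ}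
    (hn : 0 < I.n) (hL : I.n ≤ 2 ^ L) (hfuel : L ≤ fuel) (hfuel' : I.n ≤ fuel)
    (K : ℕ → σ → Prop)
    (hbody : ∀ v < I.n, ∀ k r s, K (k + 1) r → Inv I.n s → TreeOK I.n 0 (s.nat .tree) →
      wp (body v r) (fun r' s' => K k r' ∧ Inv I.n s' ∧ TreeOK I.n 0 (s'.nat .tree) ∧
        (∀ w, s'.nat .tree (I.n + w) = s.nat .tree (I.n + w)) ∧ s'.time ≤ s.time + g v) s)
    {r : σ} {s : State R} (hK : K (liveSum I.n (fun _ => 1) (s.nat .tree)) r) (hi : Inv I.n s)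
    (hT : TreeOK I.n 0 (s.nat .tree)) :
    wp (whileLoop fuel (fun _ => qNonempty) (fun r => do
        let v ← qDelMin I fuel
        body v r) r)
      (fun r' s' => (∃ k, K k r') ∧ Inv I.n s' ∧ TreeOK I.n 0 (s'.nat .tree) ∧
        s'.time ≤ s.time + (3 + ∑ v ∈ Finset.range I.n, (g v + (9 * L + 8)))) s := by
  -- Two potentials over the live leaves: with weight `1` they bound the remaining rounds, with
  -- weight `g v + (9 * L + 8)` the remaining time. Here `9 * L + 8` pays for the loop test and the
  -- deletion.
  refine wp_whileLoop (fun m r s' => K m r ∧ Inv I.n s' ∧ TreeOK I.n 0 (s'.nat .tree) ∧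
    m = liveSum I.n (fun _ => 1) (s'.nat .tree) ∧
    s'.time + liveSum I.n (fun v => g v + (9 * L + 8)) (s'.nat .tree) ≤
      s.time + ∑ v ∈ Finset.range I.n, (g v + (9 * L + 8))) ?_
    (k := liveSum I.n (fun _ => 1) (s.nat .tree)) ?_ ?_
  · rintro k r s' ⟨hK, hi, hT, rfl, ht⟩
    unfold qNonempty
    simp only [wp_bind, wp_rd, wp_op, decide_eq_true_eq]
    have hi' := (hi.ticked.touch (c := (Sum.inl .tree, 1)) (by dsimp only; omega)).ticked
    split_ifs with h1
    · obtain ⟨v, hv, hr, hlive⟩ := hT.root hn h1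
      unfold qDelMin
      simp only [wp_bind, wp_rd, wp_op, wp_wr, wp_pure, State.touch_nat, State.ticked_nat, hr,
        Nat.add_sub_cancel]
      have hi'' := (hi'.touch (c := (Sum.inl .tree, 1)) (by dsimp only; omega)).ticked
      have hne : s'.nat .tree (I.n + v) ≠ 0 := by omega
      refine ⟨liveSum I.n (fun _ => 1) (s'.nat .tree) - 1, ?_, ?_⟩
      · have := liveSum_remove (g := fun _ => 1)
          (T' := fun j => if j = I.n + v then 0 else s'.nat .tree j) hv hne (by simp)
        omega
      refine wp_mono (wp_set_leaf_climb hi'' hT hv (.inl rfl) hL hfuel) ?_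
      rintro _ s1 ⟨hi1, hT1, -, hl1, ht1⟩
      simp only [State.touch_nat, State.ticked_nat, State.touch_time, State.ticked_time] at hl1 ht1
      have e1 := liveSum_remove (g := fun _ => 1) hv hne hl1
      have e2 := liveSum_remove (g := fun v => g v + (9 * L + 8)) hv hne hl1
      rw [← e1] at hK
      refine wp_mono (hbody v hv _ r s1 hK hi1 hT1) ?_
      rintro r' s2 ⟨hK2, hi2, hT2, hl2, ht2⟩
      refine ⟨?_, hi2, hT2, ?_, ?_⟩
      · rwa [← e1, Nat.add_sub_cancel]
      · rw [liveSum_congr hl2]; omega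
      · rw [liveSum_congr hl2]; omega
    · exact ⟨⟨_, hK⟩, hi', hT, by simp; omega⟩
  · exact (liveSum_le _ _).trans (by simpa using hfuel')
  · exact ⟨hK, hi, hT, rfl, Nat.add_le_add_left (liveSum_le _ _) _⟩

end Tree

/-! ## The two-hop spanning tree -/

section SpanningTree

variable {R : Type} [Field R] [LinearOrder R]

theorem lt_of_mem_nbrList {n : ℕ} {G : SimpleGraph (Fin n)} {v w : ℕ} (h : w ∈ nbrList G v) :
    w < n := by
  simpa using (List.mem_filter.1 h).1

theorem wp_prim {I : Input R} {fuel L : ℕ} {s : State R} (hi : Inv I.n s)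
    (h0 : ∀ j, s.nat .tree j = 0) (hL : I.n ≤ 2 ^ L) (hfuel : L ≤ fuel) (hfuel' : I.n ≤ fuel) :
    wp (prim I fuel) (fun _ s' => Inv I.n s' ∧ TreeOK I.n 0 (s'.nat .tree) ∧
      s'.time ≤ s.time + (50 * L + 60) * (I.n + ∑ v ∈ Finset.range I.n, (I.hop2 v).length + 1))
      s := by
  have hs := I.s.isLt
  unfold prim
  simp only [wp_bind]
  refine wp_forLoop_range (fun k _ s' => Inv I.n s' ∧ (∀ j, s'.nat .tree j = 0) ∧
    s'.time ≤ s.time + 2 * k) ⟨hi, h0, by simp⟩ ?_ ?_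
  · rintro k hk - s' ⟨hi, h0, ht⟩
    rw [wp_wr]
    refine ⟨hi.ticked.setNat hk (Nat.zero_le _), fun j => ?_, ?_⟩
    · rw [State.setNat_nat_self]
      simp [h0]
    · simp only [State.setNat_time, State.ticked_time]; omega
  rintro - s1 ⟨hi1, h1, ht1⟩
  simp only [wp_wrR, wp_wr]
  have hT : TreeOK I.n 0 (s1.nat .tree) := ⟨fun v _ => .inl (h1 _), fun p _ _ _ => by simp [h1]⟩
  refine wp_mono (wp_qInsert (L := L) ((hi1.ticked.setReal (by omega)).setNat (by omega)
    (Nat.zero_le _)) (by simpa using hT) hs hL hfuel) ?_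
  rintro - s2 ⟨hi2, hT2, -, ht2⟩
  simp only [State.setNat_time, State.setReal_time, State.ticked_time] at ht2
  refine wp_forLoop_range (fun k _ s' => Inv I.n s' ∧ TreeOK I.n 0 (s'.nat .tree) ∧
    s'.time ≤ s2.time + (9 * L + 6) * k) ⟨hi2, hT2, by simp⟩ ?_ ?_
  · rintro k hk - s' ⟨hi, hT, ht⟩
    rw [wp_ite]
    split_ifs with hks
    · simp only [wp_bind, wp_wrR, wp_wr]
      refine wp_mono (wp_qInsert (L := L) ((hi.ticked.setReal (by omega)).setNat (by omega)
        (Nat.zero_le _)) (by simpa using hT) hk hL hfuel) ?_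
      rintro - s3 ⟨hi3, hT3, -, ht3⟩
      simp only [State.setNat_time, State.setReal_time, State.ticked_time] at ht3
      exact ⟨hi3, hT3, by rw [mul_add]; omega⟩
    · rw [wp_pure]
      exact ⟨hi.ticked, hT, by rw [mul_add, State.ticked_time]; omega⟩
  rintro - s3 ⟨hi3, hT3, ht3⟩
  -- Each two-hop neighbour costs at most `9 * L + 3` steps for a key change and `8` for the rest;
  -- the last step is the final loop test.
  refine wp_mono (wp_drain (L := L) (g := fun v => (9 * L + 11) * (I.hop2 v).length + 1)
    (by omega) hL hfuel hfuel' (fun _ _ => True) ?_ trivial hi3.ticked hT3) ?_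
  · rintro v hv - - s4 - hi4 hT4
    refine wp_forLoop (fun k _ s' => Inv I.n s' ∧ TreeOK I.n 0 (s'.nat .tree) ∧
      (∀ w, s'.nat .tree (I.n + w) = s4.nat .tree (I.n + w)) ∧
      s'.time + (9 * L + 11) * k ≤ s4.time + (9 * L + 11) * (I.hop2 v).length)
      ⟨hi4, hT4, fun _ => rfl, le_rfl⟩ ?_ ?_
    · rintro w hw k - s5 ⟨hi5, hT5, hl5, ht5⟩
      have hwn : w < I.n := lt_of_mem_nbrList hw
      rw [mul_add] at ht5
      unfold qMem
      simp only [wp_bind, wp_op, wp_rd, wp_rdR, wp_ite, wp_pure, wp_wr, decide_eq_true_eq]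
      have hi6 := (hi5.ticked.touch (c := (Sum.inl .tree, I.n + w)) (by dsimp only; omega)).ticked
      have hi7 := (hi6.touch (c := (Sum.inr .key, w)) (by dsimp only; omega)).ticked.ticked.ticked
      split_ifs
      · refine wp_mono (wp_qSetKey hi7 hT5 hwn hL hfuel) ?_
        rintro - s8 ⟨hi8, hT8, hF8, ht8⟩
        simp only [State.touch_time, State.ticked_time] at ht8
        refine ⟨hi8.setNat (by omega) (show v + 1 ≤ I.n by omega), by simpa using hT8,
          fun w => ?_, ?_⟩
        · rw [State.setNat_nat_of_ne _ _ _ _ (by decide), hF8.leaves]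
          exact hl5 w
        · simp only [State.setNat_time]; omega
      · exact ⟨hi7, hT5, hl5, by simp only [State.touch_time, State.ticked_time]; omega⟩
      · exact ⟨hi6, hT5, hl5, by simp only [State.touch_time, State.ticked_time]; omega⟩
    · rintro - s5 ⟨hi5, hT5, hl5, ht5⟩
      exact ⟨trivial, hi5.ticked, hT5, hl5, by rw [State.ticked_time]; omega⟩
  · rintro - s4 ⟨-, hi4, hT4, ht4⟩
    refine ⟨hi4, hT4, ?_⟩
    simp only [Finset.sum_add_distrib, ← Finset.mul_sum, Finset.sum_const, Finset.card_range,
      smul_eq_mul, State.ticked_time] at ht4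
    set S := ∑ v ∈ Finset.range I.n, (I.hop2 v).length
    nlinarith [Nat.zero_le (L * I.n), Nat.zero_le (L * S)]

theorem wp_twoHopMST {I : Input R} {fuel L : ℕ} {s : State R} (hi : Inv I.n s)
    (h0 : ∀ j, s.nat .tree j = 0) (hL : I.n ≤ 2 ^ L) (hfuel : L ≤ fuel) (hfuel' : I.n ≤ fuel) :
    wp (twoHopMST I fuel) (fun h s' => h ≤ I.n ∧ Inv I.n s' ∧
      s'.time ≤ s.time + (80 * L + 100) * (I.n + ∑ v ∈ Finset.range I.n, (I.hop2 v).length + 1))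
      s := by
  have hs := I.s.isLt
  unfold twoHopMST
  simp only [wp_bind]
  refine wp_mono (wp_prim hi h0 hL hfuel hfuel') ?_
  rintro - s1 ⟨hi1, hT1, ht1⟩
  refine wp_forLoop_range (fun k _ s' => Inv I.n s' ∧ TreeOK I.n 0 (s'.nat .tree) ∧
    s'.time ≤ s1.time + (9 * L + 5) * k) ⟨hi1, hT1, by simp⟩ ?_ ?_
  · rintro k hk - s' ⟨hi, hT, ht⟩
    simp only [wp_bind, wp_rd, wp_ite, wp_pure]
    have hi' := hi.ticked.touch (c := (Sum.inl .parent, k)) (by dsimp only; omega)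
    split_ifs
    · refine wp_mono (wp_qInsert hi' hT hk hL hfuel) ?_
      rintro - s3 ⟨hi3, hT3, -, ht3⟩
      simp only [State.touch_time, State.ticked_time] at ht3
      exact ⟨hi3, hT3, by rw [mul_add]; omega⟩
    · exact ⟨hi', hT, by simp only [mul_add, State.touch_time, State.ticked_time]; omega⟩
  rintro - s2 ⟨hi2, hT2, ht2⟩
  -- The number `t` of entries written plus the number of queued elements never exceeds `n`. This
  -- keeps `t` in range and needs no proof that `prim` left the queue empty.
  refine wp_mono (wp_drain (L := L) (g := fun _ => 2)
    (by omega) hL hfuel hfuel' (fun k t => t + k ≤ I.n) ?_ ?_ hi2.ticked hT2) ?_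
  · rintro v hv k t s3 hk hi3 hT3
    simp only [wp_bind, wp_wr, wp_op]
    refine ⟨by omega, (hi3.setNat (a := .H) (x := v) (by omega) hv).ticked, by simpa using hT3,
      fun w => ?_, ?_⟩
    · rw [State.ticked_nat, State.setNat_nat_of_ne _ _ _ _ (by decide)]
    · simp
  · rw [zero_add]
    exact (liveSum_le _ _).trans (by simp)
  · rintro h s4 ⟨⟨k, hk⟩, hi4, hT4, ht4⟩
    refine ⟨by omega, hi4, ?_⟩
    simp only [Finset.sum_const, Finset.card_range, smul_eq_mul, State.ticked_time] at ht4
    set S := ∑ v ∈ Finset.range I.n, (I.hop2 v).length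
    nlinarith [Nat.zero_le (L * I.n), Nat.zero_le (L * S)]

end SpanningTree

/-! ## Union-find -/

section UnionFind

variable {R : Type} {n B : ℕ}

/-- `ρ x` is the root of `x` in the union-find forest, and ranks, which are at most `B`, increase
along the pointers. -/
structure Forest (n B : ℕ) (ρ uf rank : ℕ → ℕ) : Prop where
  root_lt : ∀ x < n, ρ x < n
  root_uf : ∀ x < n, ρ (uf x) = ρ x
  root_of_fixed : ∀ x < n, uf x = x → ρ x = x
  fixed_root : ∀ x < n, uf (ρ x) = ρ x
  rank_uf : ∀ x < n, uf x ≠ x → rank x < rank (uf x)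
  rank_root : ∀ x < n, ρ x ≠ x → rank x < rank (ρ x)
  rank_le : ∀ x < n, rank x ≤ B

/-- Roots do not change, and `rank_root` supplies exactly the rank increase required of the new
pointer from `y` to its root. -/
theorem Forest.compress {ρ uf rank : ℕ → ℕ} (h : Forest n B ρ uf rank) {y r : ℕ} (hy : y < n)
    (hr : ρ y = r) (hyr : y ≠ r) :
    Forest n B ρ (fun j => if j = y then r else uf j) rank := by
  subst hr
  have hlt := h.root_lt y hy
  have hfix := h.fixed_root y hy
  have hidem := h.root_of_fixed _ hlt hfix
  refine ⟨h.root_lt, fun x hx => ?_, fun x hx hxx => ?_, fun x hx => ?_, fun x hx hxx => ?_,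
    h.rank_root, h.rank_le⟩
  · split_ifs with hxy
    · rw [hidem, hxy]
    · exact h.root_uf x hx
  · split_ifs at hxx with hxy
    · exact absurd (hxy.symm.trans hxx.symm) hyr
    · exact h.root_of_fixed x hx hxx
  · split_ifs with hxy
    · have := h.fixed_root x hx
      rw [hxy] at this
      have := h.root_of_fixed y hy this
      rw [hxy]; exact absurd this.symm hyr
    · exact h.fixed_root x hx
  · split_ifs at hxx ⊢ with hxy
    · rw [hxy]; exact h.rank_root y hy (Ne.symm hyr)
    · exact h.rank_uf x hx hxx

theorem Forest.mono {ρ uf rank : ℕ → ℕ} (h : Forest n B ρ uf rank) {B' : ℕ} (hB : B ≤ B') :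
    Forest n B' ρ uf rank :=
  ⟨h.root_lt, h.root_uf, h.root_of_fixed, h.fixed_root, h.rank_uf, h.rank_root,
    fun x hx => (h.rank_le x hx).trans hB⟩

theorem Forest.raise_rank {ρ uf rank : ℕ → ℕ} (h : Forest n B ρ uf rank) {a : ℕ}
    (hfix : uf a = a) :
    Forest n (B + 1) ρ uf (fun j => if j = a then rank a + 1 else rank j) := by
  refine ⟨h.root_lt, h.root_uf, h.root_of_fixed, h.fixed_root, fun x hx hxx => ?_,
    fun x hx hxx => ?_, fun x hx => ?_⟩
  · have h1 := h.rank_uf x hx hxx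
    split_ifs with h2 h3 <;> grind
  · have h1 := h.rank_root x hx hxx
    have h2 := h.root_of_fixed x hx
    split_ifs with h2 h3 <;> grind
  · have := h.rank_le x hx
    split_ifs with h2
    · subst h2; omega
    · omega

/-- Hanging the root `b` below the root `a` of larger rank. -/
theorem Forest.link {ρ uf rank : ℕ → ℕ} (h : Forest n B ρ uf rank) {a b : ℕ} (ha : a < n)
    (hb : b < n) (hfa : uf a = a) (hfb : uf b = b) (hab : a ≠ b) (hrank : rank b < rank a) :
    Forest n B (fun z => if ρ z = b then a else ρ z) (fun j => if j = b then a else uf j) rank := by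
  have hra := h.root_of_fixed a ha hfa
  have hrb := h.root_of_fixed b hb hfb
  refine ⟨fun x hx => ?_, fun x hx => ?_, fun x hx hxx => ?_, fun x hx => ?_, fun x hx hxx => ?_,
    fun x hx hxx => ?_, h.rank_le⟩
  · have := h.root_lt x hx
    split_ifs <;> assumption
  · have := h.root_uf x hx
    grind
  · have := h.root_of_fixed x hx
    grind
  · have := h.fixed_root x hx
    grind
  · have := h.rank_uf x hx
    grind
  · have := h.rank_root x hx
    grind

/-- The union-find arrays contain a forest of rank at most `B`. -/
def HasForest (n B : ℕ) (s : State R) : Prop := ∃ ρ, Forest n B ρ (s.nat .uf) (s.nat .rank)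

theorem HasForest.congr {s s' : State R} (h : HasForest n B s) (h1 : s'.nat .uf = s.nat .uf)
    (h2 : s'.nat .rank = s.nat .rank) : HasForest n B s' := by
  unfold HasForest; rw [h1, h2]; exact h

/-- In both loops the rank of the current node strictly increases and stays at most `B`, so `B`
rounds suffice. The second loop leaves ranks alone and steps to the parent read before compression.
-/
theorem wp_find {fuel x : ℕ} {ρ : ℕ → ℕ} {s : State R} (hi : Inv n s)
    (hF : Forest n B ρ (s.nat .uf) (s.nat .rank)) (hx : x < n) (hfuel : B ≤ fuel) :
    wp (find fuel x) (fun r s' => r = ρ x ∧ Inv n s' ∧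
      Forest n B ρ (s'.nat .uf) (s'.nat .rank) ∧ ∀ a, a ≠ .uf → s'.nat a = s.nat a) s := by
  have hrx : ∀ y < n, s.nat .rank y ≤ B := hF.rank_le
  unfold find
  simp only [wp_bind]
  refine wp_whileLoop (fun m y s' => Inv n s' ∧ s'.nat = s.nat ∧ y < n ∧ ρ y = ρ x ∧
    B - s.nat .rank y ≤ m) ?_ ((Nat.sub_le _ _).trans hfuel) ⟨hi, rfl, hx, rfl, le_rfl⟩
  rintro k y s1 ⟨hi1, hs1, hy, hρ, hm⟩
  simp only [wp_bind, wp_rd, wp_op, decide_eq_true_eq, State.ticked_nat, State.touch_nat, hs1]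
  have hi2 := (hi1.ticked.touch (c := (Sum.inl .uf, y)) (by dsimp only; omega)).ticked
  split_ifs with hp
  · have h1 := hF.rank_uf y hy hp
    have h2 := hF.rank_le (s.nat .uf y) (hi.uf_lt y)
    exact ⟨k - 1, by omega, hi2.touch (by dsimp only; omega), trivial, hi.uf_lt y,
      (hF.root_uf y hy).trans hρ, by omega⟩
  · rw [not_ne_iff] at hp
    have hy' := hF.root_of_fixed y hy hp
    clear hm
    refine wp_whileLoop (fun m z s' => Inv n s' ∧ Forest n B ρ (s'.nat .uf) (s'.nat .rank) ∧
      (∀ a, a ≠ .uf → s'.nat a = s.nat a) ∧ z < n ∧ ρ z = y ∧ B - s.nat .rank z ≤ m) ?_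
      ((Nat.sub_le _ _).trans hfuel) ⟨hi2, by simpa [hs1] using hF, by simp [hs1], hx,
        hρ.symm.trans hy', le_rfl⟩
    rintro k z s3 ⟨hi3, hF3, hfr, hz, hρz, hm⟩
    simp only [wp_bind, wp_rd, wp_op, wp_wr, wp_pure, decide_eq_true_eq, State.ticked_nat]
    have hrank := hfr .rank (by decide)
    split_ifs with hzy
    · have hne : s3.nat .uf z ≠ z := fun h => hzy ((hF3.root_of_fixed z hz h).symm.trans hρz)
      have h1 := hF3.rank_uf z hz hne
      have h2 := hF3.rank_le (s3.nat .uf z) (hi3.uf_lt z)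
      rw [hrank] at h1 h2
      refine ⟨k - 1, by omega, ((hi3.ticked.ticked.touch (by dsimp only; omega))).setNat
        (by omega) hy, ?_, fun a ha => ?_, hi3.uf_lt z, (hF3.root_uf z hz).trans hρz, by omega⟩
      · rw [State.setNat_nat_self, State.setNat_nat_of_ne _ _ _ _ (by decide)]
        exact hF3.compress hz hρz hzy
      · rw [State.setNat_nat_of_ne _ _ _ _ ha]
        exact hfr a ha
    · exact ⟨hy'.symm.trans hρ, hi3.ticked.ticked, hF3, hfr⟩

theorem wp_Find {fuel x : ℕ} {s : State R} (hi : Inv n s) (hF : HasForest n B s) (hx : x < n)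
    (hfuel : B ≤ fuel) :
    wp (Find fuel x) (fun r s' => r < n ∧ Inv n s' ∧ HasForest n B s' ∧
      (∀ a, a ≠ .uf → s'.nat a = s.nat a) ∧ s'.time = s.time + 1) s := by
  obtain ⟨ρ, hF⟩ := hF
  refine wp_unitCost (wp_mono (wp_find hi hF hx hfuel) ?_)
  rintro r s' ⟨rfl, hi', hF', hfr⟩
  exact ⟨hF.root_lt x hx, hi'.atTime _, ⟨ρ, hF'⟩, hfr, rfl⟩

theorem wp_Merge {fuel x y : ℕ} {s : State R} (hi : Inv n s) (hF : HasForest n B s) (hx : x < n)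
    (hy : y < n) (hfuel : B ≤ fuel) :
    wp (Merge fuel x y) (fun _ s' => Inv n s' ∧ HasForest n (B + 1) s' ∧
      s'.time = s.time + 1) s := by
  obtain ⟨ρ, hF⟩ := hF
  refine wp_unitCost ?_
  unfold unite
  simp only [wp_bind]
  refine wp_mono (wp_find hi hF hx hfuel) ?_
  rintro a s1 ⟨rfl, hi1, hF1, -⟩
  refine wp_mono (wp_find hi1 hF1 hy hfuel) ?_
  rintro b s2 ⟨rfl, hi2, hF2, -⟩
  have ha := hF2.root_lt x hx
  have hb := hF2.root_lt y hy
  have hfa := hF2.fixed_root x hx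
  have hfb := hF2.fixed_root y hy
  simp only [wp_ite, wp_bind, wp_rd, wp_wr, wp_pure]
  have hi3 := (hi2.touch (c := (Sum.inl .rank, ρ x)) (by dsimp only; omega)).touch
      (c := (Sum.inl .rank, ρ y)) (by dsimp only; omega)
  split_ifs with hab h1 h2 <;> try simp only [State.touch_nat] at *
  · refine ⟨(hi3.setNat (a := .uf) (x := ρ y) (by omega) hb).atTime _,
      ⟨fun z => if ρ z = ρ x then ρ y else ρ z, ?_⟩, rfl⟩
    simpa [State.setNat_nat_self] using (hF2.link hb ha hfb hfa (Ne.symm hab) h1).mono (Nat.le_succ B)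
  -- Equal ranks: the two writes concern different arrays, so the rank may be raised before linking,
  -- which makes the inequality required by `Forest.link` strict.
  · refine ⟨((hi3.setNat (a := .uf) (x := ρ x) (by omega) ha).setNat (by omega) (by trivial)).atTime _,
      ⟨fun z => if ρ z = ρ y then ρ x else ρ z, ?_⟩, rfl⟩
    simpa [State.setNat_nat_self] using (hF2.raise_rank hfa).link ha hb hfa hfb hab
      (by simp [hab.symm]; omega)
  · refine ⟨(hi3.setNat (a := .uf) (x := ρ x) (by omega) ha).atTime _,
      ⟨fun z => if ρ z = ρ y then ρ x else ρ z, ?_⟩, rfl⟩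
    simpa [State.setNat_nat_self] using (hF2.link ha hb hfa hfb hab (by omega)).mono (Nat.le_succ B)
  · exact ⟨hi2.atTime _, ⟨ρ, hF2.mono (Nat.le_succ B)⟩, rfl⟩

/-- After `k` merges ranks are at most `k`. This crude bound is enough, because ranks serve only for
termination. -/
theorem wp_mergeFirst [Field R] [LinearOrder R] {I : Input R} {fuel t : ℕ} {s : State R}
    (hi : Inv I.n s) (ht : t ≤ I.n) (hfuel : I.n ≤ fuel) :
    wp (mergeFirst I fuel t) (fun _ s' => Inv I.n s' ∧ HasForest I.n I.n s' ∧
      s'.time ≤ s.time + (7 * I.n + 2)) s := by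
  have hs := I.s.isLt
  unfold mergeFirst
  simp only [wp_bind]
  refine wp_forLoop_range (fun k _ s' => Inv I.n s' ∧
    (∀ v < k, s'.nat .uf v = v ∧ s'.nat .rank v = 0) ∧ s'.time ≤ s.time + 3 * k)
    ⟨hi, by simp, by simp⟩ ?_ ?_
  · rintro k hk - s1 ⟨hi1, h1, ht1⟩
    rw [wp_bind, wp_wr, wp_wr]
    refine ⟨((hi1.ticked.setNat (a := .uf) (x := k) (by omega) hk).setNat (by omega) (by trivial)),
      fun v hv => ?_, ?_⟩
    · have := h1 v
      simp only [State.setNat_nat, State.ticked_nat]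
      grind
    · simp only [State.setNat_time, State.ticked_time]; omega
  rintro - s1 ⟨hi1, h1, ht1⟩
  refine wp_forLoop_range (fun k _ s' => Inv I.n s' ∧ HasForest I.n k s' ∧
    s'.time ≤ s1.time + 1 + 4 * k) ⟨hi1.ticked, ⟨fun x => x, ?_⟩, by simp⟩ ?_ ?_
  · constructor <;> intro x hx <;> simp [h1 x hx, hx]
  · rintro k hk - s2 ⟨hi2, hF2, ht2⟩
    simp only [wp_bind, wp_rd]
    have hH := hi2.H_lt k
    have hp := hi2.parent_le (s2.nat .H k)
    have hi3 := (hi2.ticked.touch (c := (Sum.inl .H, k)) (by dsimp only; omega)).touch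
      (c := (Sum.inl .parent, s2.nat .H k)) (by dsimp only; omega)
    -- By truncated subtraction `p - 1` is a node even if `p = 0`, so nothing about the meaning of
    -- `H` is needed.
    refine wp_mono (wp_Merge (B := k) hi3 (hF2.congr rfl rfl) hH
      (by simp only [State.touch_nat, State.ticked_nat]; omega) (by omega)) ?_
    rintro - s4 ⟨hi4, hF4, ht4⟩
    simp only [State.touch_time, State.ticked_time] at ht4
    exact ⟨hi4, hF4, by omega⟩
  · rintro - s2 ⟨hi2, ⟨ρ, hF2⟩, ht2⟩
    exact ⟨hi2.ticked, ⟨ρ, hF2.mono ht⟩, by rw [State.ticked_time]; omega⟩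

end UnionFind

/-! ## The scan of the pairs of supernodes -/

section Scan

variable {R : Type} {n : ℕ}

/-- The lists starting in `head` and continued in `next` contain nodes below `k` and are
decreasing, and the list of `i` consists of nodes `v` with `own v = i`. -/
structure Lists (n k : ℕ) (own head next : ℕ → ℕ) : Prop where
  head_le : ∀ r < n, head r ≤ k
  head_own : ∀ r < n, head r ≠ 0 → own (head r - 1) = r
  next_le : ∀ v < k, next v ≤ v
  next_own : ∀ v < k, next v ≠ 0 → own (next v - 1) = own v

/-- All listed nodes are below `k`, so giving `k` an owner disturbs no list, and `k` in front of the
list of `r` keeps it decreasing. -/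
theorem Lists.push {k r : ℕ} {own head next : ℕ → ℕ} (h : Lists n k own head next) (hr : r < n) :
    Lists n (k + 1) (fun j => if j = k then r else own j)
      (fun j => if j = r then k + 1 else head j) (fun j => if j = k then head r else next j) := by
  have hkr := h.head_le r hr
  have hor := h.head_own r hr
  refine ⟨fun q hq => ?_, fun q hq => ?_, fun v hv => ?_, fun v hv => ?_⟩
  · have := h.head_le q hq
    grind
  · have := h.head_le q hq
    have := h.head_own q hq
    grind
  · have := h.next_le v
    grind
  · have := h.next_le v
    have := h.next_own v
    grind

/-- The arrays `head` and `next` contain member lists with the owner function `own`. -/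
def HasLists (n k : ℕ) (own : ℕ → ℕ) (s : State R) : Prop :=
  Lists n k own (s.nat .head) (s.nat .next)

theorem wp_members [Field R] {I : Input R} {fuel : ℕ} {s : State R} (hi : Inv I.n s)
    (hF : HasForest I.n I.n s) (hfuel : I.n ≤ fuel) :
    wp (members I fuel) (fun _ s' => Inv I.n s' ∧ HasForest I.n I.n s' ∧
      (∃ own, HasLists I.n I.n own s') ∧ (∀ j < I.n, s'.nat .count j = 0) ∧
      s'.time ≤ s.time + (11 * I.n + 2)) s := by
  unfold members
  simp only [wp_bind]
  refine wp_forLoop_range (fun k _ s' => Inv I.n s' ∧ HasForest I.n I.n s' ∧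
    (∀ j < k, s'.nat .count j = 0 ∧ s'.nat .head j = 0) ∧
    s'.time ≤ s.time + 4 * k) ⟨hi, hF, by simp, by simp⟩ ?_ ?_
  · rintro k hk - s1 ⟨hi1, hF1, h1, ht1⟩
    rw [wp_bind, wp_wr, wp_bind, wp_wr, wp_wr]
    refine ⟨((hi1.ticked.setNat (by omega) (Nat.zero_le _)).setNat (by omega) (by trivial)).setNat
      (by omega) (by trivial), hF1.congr (by simp) (by simp), fun j hj => ?_, ?_⟩
    · have := h1 j
      simp only [State.setNat_nat, State.ticked_nat]
      grind
    · simp only [State.setNat_time, State.ticked_time]; omega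
  rintro - s1 ⟨hi1, hF1, h1, ht1⟩
  refine wp_forLoop_range (fun k _ s' => Inv I.n s' ∧ HasForest I.n I.n s' ∧
    (∃ own, HasLists I.n k own s') ∧
    (∀ j < I.n, s'.nat .count j = 0) ∧
    s'.time ≤ s1.time + 1 + 7 * k) ⟨hi1.ticked, hF1, ⟨fun _ => 0, ?_⟩, fun j hj => (h1 j hj).1,
      by simp⟩ ?_ ?_
  · constructor <;> simp +contextual [h1]
  · rintro k hk - s2 ⟨hi2, hF2, ⟨own, hl⟩, hc, ht2⟩
    rw [wp_bind]
    refine wp_mono (wp_Find hi2.ticked hF2 hk hfuel) ?_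
    rintro r s3 ⟨hr, hi3, hF3, hfr, ht3⟩
    simp only [wp_bind, wp_rd, wp_wr, State.ticked_nat] at hfr ⊢
    have hl3 : HasLists I.n k own s3 := by
      unfold HasLists; rw [hfr _ (by decide), hfr _ (by decide)]; exact hl
    have hi4 := (((hi3.touch (c := (Sum.inl .head, r)) (by dsimp only; omega)).setNat (a := .next)
      (i := k) (x := s3.nat .head r) (by omega) (hi3.head_le r)).setNat (a := .head) (i := r)
      (x := k + 1) (by omega) hk)
    refine ⟨(hi4.touch (by dsimp only; omega)).setNat (by omega) (by trivial),
      hF3.congr (by simp) (by simp), ⟨fun j => if j = k then r else own j, ?_⟩,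
      fun j hj => ?_, ?_⟩
    · simpa [HasLists] using hl3.push hr
    · simpa [hfr] using hc j hj
    · simp only [State.setNat_time, State.touch_time, State.ticked_time] at ht3 ⊢; omega
  · rintro - s2 ⟨hi2, hF2, hl, hc, ht2⟩
    exact ⟨hi2.ticked, hF2, hl, hc, by rw [State.ticked_time]; omega⟩

/-- The first `k` entries of `keys` list all indices with nonzero `count`, whose number is at
least `k`. -/
structure Counted (n k : ℕ) (count keys : ℕ → ℕ) : Prop where
  le_card : k ≤ ((Finset.range n).filter fun j => count j ≠ 0).card
  mem_keys : ∀ j < n, count j ≠ 0 → ∃ t < k, keys t = j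

theorem Counted.le {k : ℕ} {count keys : ℕ → ℕ} (h : Counted n k count keys) : k ≤ n :=
  h.le_card.trans ((Finset.card_filter_le _ _).trans (by simp))

/-- An index not yet counted leaves room for one more key, so the write to `keys` stays in range. -/
theorem Counted.lt {k j : ℕ} {count keys : ℕ → ℕ} (h : Counted n k count keys) (hj : j < n)
    (h0 : count j = 0) : k < n := by
  refine h.le_card.trans_lt ?_
  calc _ < (Finset.range n).card := Finset.card_lt_card (Finset.filter_ssubset.2
        ⟨j, Finset.mem_range.2 hj, by simpa using h0⟩)
    _ = n := by simp

theorem Counted.set {k j x : ℕ} {count keys : ℕ → ℕ} (h : Counted n k count keys)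
    (h0 : count j ≠ 0) : Counted n k (fun i => if i = j then x + 1 else count i) keys := by
  have : ∀ i, (if i = j then x + 1 else count i) ≠ 0 ↔ count i ≠ 0 := by grind
  exact ⟨by simpa only [this] using h.le_card, fun i hi hc => h.mem_keys i hi ((this i).1 hc)⟩

theorem Counted.push {k j x : ℕ} {count keys : ℕ → ℕ} (h : Counted n k count keys)
    (hj : j < n) (h0 : count j = 0) :
    Counted n (k + 1) (fun i => if i = j then x + 1 else count i)
      (fun i => if i = k then j else keys i) := by
  refine ⟨?_, fun i hi hc => ?_⟩
  · have : (Finset.range n).filter (fun i => (if i = j then x + 1 else count i) ≠ 0) =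
        insert j ((Finset.range n).filter fun i => count i ≠ 0) := by
      ext i
      simp only [Finset.mem_filter, Finset.mem_range, Finset.mem_insert]
      grind
    rw [this, Finset.card_insert_of_notMem (by simp [h0])]
    exact Nat.succ_le_succ h.le_card
  · split_ifs at hc with hij
    · exact ⟨k, by omega, by simp [hij]⟩
    · obtain ⟨t, ht, hk⟩ := h.mem_keys i hi hc
      exact ⟨t, by omega, by simp [hk, ht.ne]⟩

/-- The work spent on the members below `q` of the supernode `i`. -/
noncomputable def memberWork (I : Input R) (own : ℕ → ℕ) (i q : ℕ) : ℕ :=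
  ∑ u ∈ Finset.range q, if own u = i then 30 * (I.nbrs u).length + 10 else 0

theorem memberWork_mono (I : Input R) (own : ℕ → ℕ) (i : ℕ) {q q' : ℕ} (h : q ≤ q') :
    memberWork I own i q ≤ memberWork I own i q' :=
  Finset.sum_le_sum_of_subset (by simpa using h)

theorem memberWork_succ (I : Input R) {own : ℕ → ℕ} {i u : ℕ} (h : own u = i) :
    memberWork I own i (u + 1) = memberWork I own i u + (30 * (I.nbrs u).length + 10) := by
  simp [memberWork, Finset.sum_range_succ, h]

/-- Each node has one owner, so its neighbourhood is paid for at most once in a whole scan. -/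
theorem sum_memberWork_le (I : Input R) (own : ℕ → ℕ) (m q : ℕ) :
    ∑ i ∈ Finset.range m, memberWork I own i q ≤
      ∑ u ∈ Finset.range q, (30 * (I.nbrs u).length + 10) := by
  unfold memberWork
  rw [Finset.sum_comm]
  refine Finset.sum_le_sum fun u _ => ?_
  rw [Finset.sum_ite_eq]
  split_ifs <;> simp

variable [Field R]

/-- Collecting leaves a credit of `20` steps for every listed key. -/
theorem wp_collect {I : Input R} {fuel i : ℕ} {own : ℕ → ℕ} {s : State R} (hi : Inv I.n s)
    (hF : HasForest I.n I.n s) (hl : HasLists I.n I.n own s) (hc : ∀ j < I.n, s.nat .count j = 0)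
    (hin : i < I.n) (hfuel : I.n ≤ fuel) :
    wp (collect I fuel i) (fun k s' => Inv I.n s' ∧ HasForest I.n I.n s' ∧ HasLists I.n I.n own s' ∧
      Counted I.n k (s'.nat .count) (s'.nat .keys) ∧
      s'.time + 20 * k ≤ s.time + (memberWork I own i I.n + 5)) s := by
  unfold collect
  simp only [wp_bind, wp_rd, wp_pure]
  -- As the list decreases, the shifted pointer `p.1` bounds the remaining rounds and `memberWork I
  -- own i p.1` pays for the members still to come. Of the `30` steps per neighbour at most `8` are
  -- spent and `20` are saved for a possible new key.
  refine wp_whileLoop (fun m p s' => Inv I.n s' ∧ HasForest I.n I.n s' ∧ HasLists I.n I.n own s' ∧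
    Counted I.n p.2 (s'.nat .count) (s'.nat .keys) ∧ p.1 ≤ m ∧ p.1 ≤ I.n ∧
    (p.1 ≠ 0 → own (p.1 - 1) = i) ∧
    s'.time + 20 * p.2 + memberWork I own i p.1 ≤ s.time + (memberWork I own i I.n + 1)) ?_ hfuel
    ⟨hi.touch (by dsimp only; omega), hF, hl, ⟨by simp, fun j hj h => absurd (hc j hj) h⟩,
      hi.head_le i, hi.head_le i, hl.head_own i hin, ?_⟩
  · rintro m ⟨p, k⟩ s1 ⟨hi1, hF1, hl1, hC1, hpm, hpn, hown, ht1⟩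
    dsimp only at hC1 hpm hpn hown ht1 ⊢
    simp only [wp_op, decide_eq_true_eq]
    split_ifs with hp
    · obtain ⟨u, rfl⟩ : ∃ u, p = u + 1 := ⟨p - 1, by omega⟩
      have hu : own u = i := hown (by omega)
      rw [memberWork_succ I hu] at ht1
      refine ⟨m - 1, by omega, ?_⟩
      simp only [wp_bind, wp_op, Nat.add_sub_cancel]
      refine wp_forLoop (fun q k s' => Inv I.n s' ∧ HasForest I.n I.n s' ∧ HasLists I.n I.n own s' ∧
        Counted I.n k (s'.nat .count) (s'.nat .keys) ∧
        s'.time + 20 * k + 30 * q + memberWork I own i u + 7 ≤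
          s.time + (memberWork I own i I.n + 1))
        ⟨hi1.ticked.ticked.ticked, hF1, hl1, hC1, by
          simp only [State.ticked_time]; omega⟩ ?_ ?_
      · rintro v hv q k s2 ⟨hi2, hF2, hl2, hC2, ht2⟩
        rw [wp_bind]
        refine wp_mono (wp_Find hi2.ticked hF2 (lt_of_mem_nbrList hv) hfuel) ?_
        rintro j s3 ⟨hj, hi3, hF3, hfr, ht3⟩
        simp only [State.ticked_nat, State.ticked_time] at hfr ht3
        have hl3 : HasLists I.n I.n own s3 := by
          unfold HasLists; rw [hfr _ (by decide), hfr _ (by decide)]; exact hl2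
        have hC3 : Counted I.n k (s3.nat .count) (s3.nat .keys) := by
          rw [hfr _ (by decide), hfr _ (by decide)]; exact hC2
        simp only [wp_ite, wp_bind, wp_op, wp_rd, wp_rdR, wp_wr, wp_wrR, wp_pure]
        have hi4 := (hi3.touch (c := (Sum.inl .count, j)) (by dsimp only; omega)).ticked
        split_ifs with h1 h2
        · refine ⟨((hi4.setNat (by omega) (by trivial)).touch (by dsimp only; omega)).setReal
            (by omega), hF3.congr (by simp) (by simp), ?_, ?_, ?_⟩
          · simpa [HasLists] using hl3
          · simpa using hC3.set (j := j) (x := s3.nat .count j) (by omega)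
          · simp only [State.setNat_time, State.touch_time, State.ticked_time,
              State.setReal_time]; omega
        · have h0 : s3.nat .count j = 0 := by omega
          have hk := hC3.lt hj h0
          refine ⟨(((hi4.setNat (by omega) (by trivial)).setReal (by omega)).setNat (a := .keys)
            (x := j) (by omega) hj).ticked, hF3.congr (by simp) (by simp), ?_, ?_, ?_⟩
          · simpa [HasLists] using hl3
          · simpa using hC3.push (x := 0) hj h0
          · simp only [State.setNat_time, State.touch_time, State.ticked_time,
              State.setReal_time]; omega
        · exact ⟨hi3, hF3, hl3, hC3, by omega⟩
      · rintro k s2 ⟨hi2, hF2, hl2, hC2, ht2⟩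
        have hle := hl2.next_le u (by omega)
        have hno := hl2.next_own u (by omega)
        simp only [wp_rd, wp_pure, State.ticked_nat]
        refine ⟨hi2.ticked.touch (by dsimp only; omega), hF2, hl2, hC2, by omega, by omega,
          fun h => (hno h).trans hu, ?_⟩
        have := memberWork_mono I own i hle
        simp only [State.touch_time, State.ticked_time]; omega
    · refine ⟨hi1.ticked.ticked, hF1, hl1, hC1, ?_⟩
      simp only [State.ticked_time]; omega
  · have := memberWork_mono I own i (hi.head_le i)
    simp only [State.touch_time]; omega

/-- The treatment of a pair of supernodes takes at most one step and leaves the memory alone. -/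
def Light (visit : ℕ → ℕ → R → R → R → M R R) : Prop :=
  ∀ i j a b r, ∀ s : State R, wp (visit i j a b r) (fun _ s' => s'.nat = s.nat ∧
    s'.cells = s.cells ∧ s'.ok = s.ok ∧ s'.time ≤ s.time + 1) s

theorem wp_scanPairs {I : Input R} {fuel m : ℕ} {r : R} {visit : ℕ → ℕ → R → R → R → M R R}
    {s : State R} (hv : Light visit) (hi : Inv I.n s) (hF : HasForest I.n I.n s)
    (hfuel : I.n ≤ fuel) :
    wp (scanPairs I fuel m r visit) (fun _ s' => Inv I.n s' ∧
      s'.time ≤ s.time + (40 * I.n + 30 * ∑ u ∈ Finset.range I.n, (I.nbrs u).length + 3)) s := by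
  unfold scanPairs
  simp only [wp_bind]
  refine wp_mono (wp_members hi hF hfuel) ?_
  rintro - s1 ⟨hi1, hF1, ⟨own, hl1⟩, hc1, ht1⟩
  refine wp_forLoop_range (fun k _ s' => Inv I.n s' ∧ HasForest I.n I.n s' ∧ HasLists I.n I.n own s' ∧
    (∀ j < I.n, s'.nat .count j = 0) ∧
    s'.time ≤ s1.time + ∑ i ∈ Finset.range k, (memberWork I own i I.n + 10))
    ⟨hi1, hF1, hl1, hc1, by simp⟩ ?_ ?_
  · rintro i hin r s2 ⟨hi2, hF2, hl2, hc2, ht2⟩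
    simp only [wp_bind, wp_rd, wp_ite, wp_pure, Finset.sum_range_succ]
    have hi3 := hi2.ticked.touch (c := (Sum.inl .size, i)) (by dsimp only; omega)
    split_ifs with hsz
    · refine ⟨hi3, hF2, hl2, hc2, ?_⟩
      simp only [State.touch_time, State.ticked_time]; omega
    refine wp_mono (wp_collect hi3 (hF2.congr rfl rfl) hl2 hc2 hin hfuel) ?_
    rintro nk s4 ⟨hi4, hF4, hl4, hC4, ht4⟩
    have hnk := hC4.le
    simp only [State.touch_time, State.ticked_time] at ht4
    -- Nonzero counts are listed at positions from `t` on, so at the end `count` is zero again for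
    -- the next supernode. The saved `20` steps per key pay for this loop.
    refine wp_forLoop_range (fun t _ s' => Inv I.n s' ∧ HasForest I.n I.n s' ∧
      HasLists I.n I.n own s' ∧
      (∀ j < I.n, s'.nat .count j ≠ 0 → ∃ t', t ≤ t' ∧ t' < nk ∧ s'.nat .keys t' = j) ∧
      s'.time ≤ s4.time + 20 * t)
      ⟨hi4, hF4, hl4, fun j hj h => by simpa using hC4.mem_keys j hj h, by simp⟩ ?_ ?_
    · rintro t htn r s5 ⟨hi5, hF5, hl5, hk5, ht5⟩
      have hj := hi5.keys_lt t
      simp only [wp_ite, wp_bind, wp_op, wp_rd, wp_rdR, wp_wr, wp_pure]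
      have hi6 := (((hi5.ticked.touch (c := (Sum.inl .keys, t)) (by dsimp only; omega)).touch
        (c := (Sum.inl .count, s5.nat .keys t)) (by dsimp only; omega)).setNat (a := .count)
        (i := s5.nat .keys t) (x := 0) (by omega) (by trivial))
      have hk6 : ∀ j < I.n, (if j = s5.nat .keys t then 0 else s5.nat .count j) ≠ 0 →
          ∃ t', t + 1 ≤ t' ∧ t' < nk ∧ s5.nat .keys t' = j := by
        intro j hj h
        split_ifs at h with hjt
        · exact absurd rfl h
        · obtain ⟨t', h1, h2, h3⟩ := hk5 j hj h
          refine ⟨t', ?_, h2, h3⟩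
          rcases h1.eq_or_lt with rfl | h1
          · exact absurd h3.symm hjt
          · exact h1
      by_cases hij : i ≤ s5.ticked.nat .keys t
      · rw [if_pos hij]
        have hi7 := ((hi6.touch (c := (Sum.inr .sum, s5.nat .keys t))
          (by dsimp only; omega)).ticked.touch (c := (Sum.inl .size, s5.nat .keys t))
          (by dsimp only; omega)).ticked.ticked.ticked
        refine wp_mono (hv _ _ _ _ _ _) ?_
        rintro r' s8 ⟨hn8, hc8, ho8, ht8⟩
        refine ⟨⟨ho8.trans hi7.ok, fun c hc => hi7.cells c (by rwa [hc8] at hc),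
          fun a i => by rw [hn8]; exact hi7.fits a i⟩,
          hF5.congr (by rw [hn8]; simp) (by rw [hn8]; simp), ?_, ?_, ?_⟩
        · unfold HasLists; rw [hn8]; simpa [HasLists] using hl5
        · rw [hn8]; simpa using hk6
        · simp only [State.setNat_time, State.touch_time, State.ticked_time] at ht8; omega
      · rw [if_neg hij]
        refine ⟨hi6, hF5.congr (by simp) (by simp), ?_, ?_, ?_⟩
        · simpa [HasLists] using hl5
        · simpa using hk6
        · simp only [State.setNat_time, State.touch_time, State.ticked_time]; omega
    · rintro r s5 ⟨hi5, hF5, hl5, hk5, ht5⟩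
      refine ⟨hi5.ticked, hF5, hl5, fun j hj => ?_, ?_⟩
      · by_contra h
        obtain ⟨t', h1, h2, -⟩ := hk5 j hj h
        omega
      · rw [State.ticked_time]; omega
  · rintro r s2 ⟨hi2, -, -, -, ht2⟩
    have := sum_memberWork_le I own I.n I.n
    simp only [Finset.sum_add_distrib, ← Finset.mul_sum, Finset.sum_const, Finset.card_range,
      smul_eq_mul] at this ht2
    exact ⟨hi2.ticked, by rw [State.ticked_time]; omega⟩

variable [LinearOrder R]

theorem wp_computeUtility {I : Input R} {fuel m : ℕ} {s : State R} (hi : Inv I.n s)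
    (hF : HasForest I.n I.n s) (hfuel : I.n ≤ fuel) :
    wp (computeUtility I fuel m) (fun _ s' => Inv I.n s' ∧
      s'.time ≤ s.time + (40 * I.n + 30 * ∑ u ∈ Finset.range I.n, (I.nbrs u).length + 3)) s :=
  wp_scanPairs (fun _ _ _ _ _ _ => by rw [wp_op]; exact ⟨rfl, rfl, rfl, le_rfl⟩) hi hF hfuel

theorem wp_buildSuperEdges {I : Input R} {fuel m : ℕ} {s : State R} (hi : Inv I.n s)
    (hF : HasForest I.n I.n s) (hfuel : I.n ≤ fuel) :
    wp (buildSuperEdges I fuel m) (fun _ s' => Inv I.n s' ∧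
      s'.time ≤ s.time + (40 * I.n + 30 * ∑ u ∈ Finset.range I.n, (I.nbrs u).length + 3)) s := by
  unfold buildSuperEdges
  rw [wp_bind]
  refine wp_scanPairs (fun i j a b r s => ?_) hi hF hfuel
  split_ifs
  · exact ⟨rfl, rfl, rfl, le_rfl⟩
  · exact ⟨rfl, rfl, rfl, Nat.le_succ _⟩

end Scan

/-! ## Running time of T-BUDS in terms of neighbourhood sizes -/

section Total

variable {R : Type}

theorem wp_countEdges {I : Input R} {s : State R} (hi : Inv I.n s) :
    wp (countEdges I) (fun _ s' => Inv I.n s' ∧ s'.nat = s.nat ∧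
      s'.time ≤ s.time + (2 * I.n + 2 * ∑ u ∈ Finset.range I.n, (I.nbrs u).length + 1)) s := by
  unfold countEdges
  refine wp_forLoop_range (fun k _ s' => Inv I.n s' ∧ s'.nat = s.nat ∧
    s'.time ≤ s.time + (2 * k + 2 * ∑ u ∈ Finset.range k, (I.nbrs u).length))
    ⟨hi, rfl, by simp⟩ ?_ ?_
  · rintro u hu m s1 ⟨hi1, hn1, ht1⟩
    rw [Finset.sum_range_succ]
    refine wp_forLoop (fun q _ s' => Inv I.n s' ∧ s'.nat = s.nat ∧
      s'.time + 2 * q ≤ s1.time + 1 + 2 * (I.nbrs u).length) ⟨hi1.ticked, hn1, by simp⟩ ?_ ?_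
    · rintro v - q m s2 ⟨hi2, hn2, ht2⟩
      rw [wp_op]
      exact ⟨hi2.ticked.ticked, hn2, by simp only [State.ticked_time]; omega⟩
    · rintro m s2 ⟨hi2, hn2, ht2⟩
      exact ⟨hi2.ticked, hn2, by simp only [State.ticked_time]; omega⟩
  · rintro m s1 ⟨hi1, hn1, ht1⟩
    exact ⟨hi1.ticked, hn1, by simp only [State.ticked_time]; omega⟩

theorem wp_tbuds [Field R] [LinearOrder R] {I : Input R} {fuel L : ℕ} {s : State R} (hi : Inv I.n s)
    (h0 : ∀ j, s.nat .tree j = 0) (hL : I.n ≤ 2 ^ L) (hfuel : L + 1 ≤ fuel)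
    (hfuel' : I.n ≤ fuel) :
    wp (tbuds I fuel) (fun _ s' => Inv I.n s' ∧
      s'.time ≤ s.time + (L + 1) * (200 * I.n + 100 * ∑ v ∈ Finset.range I.n, (I.hop2 v).length +
        70 * ∑ v ∈ Finset.range I.n, (I.nbrs v).length + 200)) s := by
  unfold tbuds
  simp only [wp_bind]
  refine wp_mono (wp_countEdges hi) ?_
  rintro m s1 ⟨hi1, hn1, ht1⟩
  refine wp_mono (wp_twoHopMST hi1 (by rwa [hn1]) hL (by omega) hfuel') ?_
  rintro h s2 ⟨hh, hi2, ht2⟩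
  set D := ∑ v ∈ Finset.range I.n, (I.nbrs v).length
  set S := ∑ v ∈ Finset.range I.n, (I.hop2 v).length
  -- The interval halves in each round, whatever the utility is. The round cost is `7 * n + 2` for
  -- merging, `40 * n + 30 * D + 3` for the utility and `4` for control.
  refine wp_whileLoop (fun k p s' => Inv I.n s' ∧ p.2 ≤ I.n ∧ p.2 - p.1 < 2 ^ k ∧ p.1 ≤ I.n ∧
    s'.time + (47 * I.n + 30 * D + 9) * k ≤ s2.time + (47 * I.n + 30 * D + 9) * (L + 1))
    ?_ hfuel ⟨hi2, hh, ?_, Nat.zero_le _, le_rfl⟩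
  · rintro k ⟨lo, hi⟩ s3 ⟨hi3, hhi, hk, hlo, ht3⟩
    dsimp only at hhi hk hlo ⊢
    simp only [wp_op, decide_eq_true_eq]
    split_ifs with hlt
    · obtain ⟨k, rfl⟩ : ∃ m, k = m + 1 := ⟨k - 1, by
        rcases k with _ | k
        · norm_num at hk; omega
        · rfl⟩
      refine ⟨k, by omega, ?_⟩
      rw [pow_succ] at hk
      rw [mul_add] at ht3
      simp only [wp_bind, wp_op]
      refine wp_mono (wp_mergeFirst hi3.ticked.ticked.ticked (by omega) hfuel') ?_
      rintro - s4 ⟨hi4, hF4, ht4⟩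
      refine wp_mono (wp_computeUtility hi4 hF4 hfuel') ?_
      rintro u s5 ⟨hi5, ht5⟩
      simp only [State.ticked_time] at ht4
      rw [wp_ite]
      split_ifs
      all_goals
        rw [wp_op]
        refine ⟨hi5.ticked, ?_, ?_, ?_, ?_⟩ <;> simp only [State.ticked_time] <;> omega
    · refine wp_mono (wp_mergeFirst hi3.ticked.ticked hlo hfuel') ?_
      rintro - s4 ⟨hi4, hF4, ht4⟩
      refine wp_mono (wp_buildSuperEdges hi4 hF4 hfuel') ?_
      rintro - s5 ⟨hi5, ht5⟩
      refine ⟨hi5, ?_⟩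
      simp only [State.ticked_time] at ht4
      have e2 : (80 * L + 100) * (I.n + S + 1) ≤ (L + 1) * (100 * (I.n + S + 1)) := by
        rw [← mul_assoc]
        exact Nat.mul_le_mul_right _ (by omega)
      -- Edge counting, the last loop test and the final construction together.
      have e1 : 49 * I.n + 32 * D + 8 ≤ (L + 1) * (49 * I.n + 32 * D + 8) :=
        Nat.le_mul_of_pos_left _ L.succ_pos
      calc s5.time ≤ s.time + ((L + 1) * (100 * (I.n + S + 1)) +
            (L + 1) * (47 * I.n + 30 * D + 9) + (L + 1) * (49 * I.n + 32 * D + 8)) := by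
            rw [mul_comm (L + 1) (47 * I.n + 30 * D + 9)]
            have := Nat.zero_le ((47 * I.n + 30 * D + 9) * k)
            omega
        _ ≤ s.time + (L + 1) * (200 * I.n + 100 * S + 70 * D + 200) := by
            rw [← mul_add, ← mul_add]
            exact Nat.add_le_add_left (Nat.mul_le_mul_left _ (by omega)) _
  · have := I.s.isLt
    rw [pow_succ]; dsimp only; omega

end Total

end TBUDS

/-! ## Sizes of neighbourhoods in the two-hop graph -/

open Classical in
/-- A neighbour of `u` has at most one neighbour more than `u` has in the two-hop graph. -/
theorem degree_le_degree_twoHopGraph {V : Type*} [Fintype V] {G : SimpleGraph V} {u v : V}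
    (h : G.Adj u v) : G.degree v ≤ (twoHopGraph G).degree u + 1 := by
  rw [← SimpleGraph.card_neighborFinset_eq_degree, ← SimpleGraph.card_neighborFinset_eq_degree]
  refine (Finset.card_le_card fun w hw => ?_).trans
    (Finset.card_insert_le u ((twoHopGraph G).neighborFinset u))
  rw [SimpleGraph.mem_neighborFinset] at hw
  rw [Finset.mem_insert, SimpleGraph.mem_neighborFinset]
  by_cases hwu : w = u
  · exact .inl hwu
  · exact .inr ⟨Ne.symm hwu, v, h, hw⟩

open Classical in
/-- Averaging the degrees of the neighbours does not decrease the sum of the degrees. -/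
theorem sum_degree_le_sum_degree_twoHopGraph {V : Type*} [Fintype V] (G : SimpleGraph V) :
    ∑ v, G.degree v ≤ ∑ v, (twoHopGraph G).degree v + Fintype.card V := by
  -- The sum of `a u v` over `v` is the average degree of the neighbours of `u`.
  let a : V → V → ℚ := fun u v => if G.Adj u v then (G.degree v : ℚ) / G.degree u else 0
  have hdeg : ∀ u, (G.degree u : ℚ) = ∑ v, if G.Adj u v then 1 else 0 := fun u => by
    rw [Finset.sum_boole, ← SimpleGraph.card_neighborFinset_eq_degree,
      SimpleGraph.neighborFinset_eq_filter]
  have hpos : ∀ u v, G.Adj u v → (0 : ℚ) < G.degree u := fun u v h => by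
    exact_mod_cast (G.degree_pos_iff_exists_adj u).2 ⟨v, h⟩
  -- For adjacent `u`, `v` this is `x / y + y / x ≥ 2`, that is `(x - y) ^ 2 ≥ 0`.
  have h1 : 2 * ∑ u, (G.degree u : ℚ) ≤ ∑ u, ∑ v, (a u v + a v u) := by
    simp only [Finset.mul_sum, hdeg]
    refine Finset.sum_le_sum fun u _ => Finset.sum_le_sum fun v _ => ?_
    by_cases h : G.Adj u v
    · have hu := hpos u v h
      have hv := hpos v u h.symm
      simp only [a, h, h.symm, if_true]
      rw [div_add_div _ _ hu.ne' hv.ne', le_div_iff₀ (mul_pos hu hv)]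
      nlinarith [sq_nonneg ((G.degree u : ℚ) - G.degree v)]
    · simp [a, h, G.adj_comm v u]
  have h2 : ∑ u, ∑ v, (a u v + a v u) = 2 * ∑ u, ∑ v, a u v := by
    simp only [Finset.sum_add_distrib]
    rw [Finset.sum_comm (f := fun u v => a v u)]
    ring
  have h3 : ∀ u, ∑ v, a u v ≤ (twoHopGraph G).degree u + 1 := fun u => by
    by_cases hu : G.degree u = 0
    · simp only [a, hu]
      simp; positivity
    · calc ∑ v, a u v
          ≤ ∑ v, (if G.Adj u v then (1 : ℚ) else 0) * (((twoHopGraph G).degree u + 1) / G.degree u) := by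
            refine Finset.sum_le_sum fun v _ => ?_
            by_cases h : G.Adj u v
            · simp only [a, h, if_true, one_mul]
              gcongr
              exact_mod_cast degree_le_degree_twoHopGraph h
            · simp [a, h]
        _ = (twoHopGraph G).degree u + 1 := by
            rw [← Finset.sum_mul, ← hdeg, mul_div_cancel₀]
            exact_mod_cast hu
  have h4 : ∑ u, (G.degree u : ℚ) ≤ ∑ u, (((twoHopGraph G).degree u : ℚ) + 1) := by
    have := Finset.sum_le_sum fun u (_ : u ∈ Finset.univ) => h3 u
    linarith
  rw [Finset.sum_add_distrib] at h4
  have : (∑ _u : V, (1 : ℚ)) = Fintype.card V := by simp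
  rw [this] at h4
  exact_mod_cast h4

/-! ### Lengths of adjacency lists as degrees -/

namespace TBUDS

open Classical in
theorem length_nbrList {n : ℕ} (G : SimpleGraph (Fin n)) (v : Fin n) :
    (nbrList G v).length = G.degree v := by
  have hnd : (nbrList G v).Nodup := List.nodup_range.filter _
  rw [← List.toFinset_card_of_nodup hnd, ← SimpleGraph.card_neighborFinset_eq_degree,
    ← Finset.card_map Fin.valEmbedding]
  congr 1
  ext w
  simp only [nbrList, List.mem_toFinset, List.mem_filter, List.mem_range, decide_eq_true_eq,
    Finset.mem_map, SimpleGraph.mem_neighborFinset, Fin.valEmbedding_apply]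
  constructor
  · rintro ⟨-, _, hw, h⟩
    exact ⟨⟨w, hw⟩, h, rfl⟩
  · rintro ⟨w, h, rfl⟩
    exact ⟨w.isLt, v.isLt, w.isLt, h⟩

open Classical in
theorem sum_length_nbrList {n : ℕ} (G : SimpleGraph (Fin n)) :
    ∑ v ∈ Finset.range n, (nbrList G v).length = ∑ v, G.degree v := by
  rw [← Fin.sum_univ_eq_sum_range (fun v => (nbrList G v).length)]
  exact Finset.sum_congr rfl fun v _ => length_nbrList G v

theorem sum_length_hop2 {R : Type} (I : Input R) :
    ∑ v ∈ Finset.range I.n, (I.hop2 v).length = 2 * (twoHopGraph I.G).edgeSet.ncard := by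
  classical
  rw [Set.ncard_eq_toFinset_card']
  exact (sum_length_nbrList _).trans (SimpleGraph.sum_degrees_eq_twice_card_edges _)

theorem sum_length_nbrs_le {R : Type} (I : Input R) :
    ∑ v ∈ Finset.range I.n, (I.nbrs v).length ≤
      ∑ v ∈ Finset.range I.n, (I.hop2 v).length + I.n := by
  classical
  have := sum_degree_le_sum_degree_twoHopGraph I.G
  rw [← sum_length_nbrList, ← sum_length_nbrList, Fintype.card_fin] at this
  exact this

end TBUDS

/-! ### Choice of constants and fuel -/

theorem mainTheorem8 :
    ∃ c : ℝ, 0 < c ∧ ∀ (n : ℕ), 2 ≤ n → ∀ (G : SimpleGraph (Fin n)) (C : Fin n → ℝ)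
      (W : Fin n → Fin n → ℝ) (τ : ℝ) (s : Fin n),
      TBUDS.RunsWithin { n := n, G := G, C := C, W := W, τ := τ, s := s }
        (c * (((twoHopGraph G).edgeSet.ncard : ℝ) + (n : ℝ)) * Real.logb 2 (n : ℝ))
        (c * (n : ℝ)) := by
  -- Any constant at least `3 * 500` (time) and `24` (space) would do.
  refine ⟨2000, by norm_num, fun n hn G C W τ s => ?_⟩
  let I : TBUDS.Input ℝ := { n := n, G := G, C := C, W := W, τ := τ, s := s }
  -- Then `n < 2 ^ L`, while `L + 1 ≤ logb 2 n + 2 ≤ 3 * logb 2 n` because `n ≥ 2`. The fuel `n + L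
  -- + 1` dominates the round bounds `n` and `L + 1`.
  let L := Nat.log 2 n + 1
  obtain ⟨hinv, htime⟩ := TBUDS.wp_tbuds (I := I) (fuel := n + L + 1) (L := L)
    (TBUDS.inv_initial (show 0 < n by omega)) (fun _ => rfl) (Nat.lt_pow_succ_log_self one_lt_two n).le
    (by omega) (show n ≤ n + L + 1 by omega)
  refine ⟨n + L + 1, hinv.ok, ?_, ?_⟩
  · have hD := TBUDS.sum_length_nbrs_le I
    have hS := TBUDS.sum_length_hop2 I
    set D := ∑ v ∈ Finset.range I.n, (I.nbrs v).length
    set S := ∑ v ∈ Finset.range I.n, (I.hop2 v).length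
    set f := (twoHopGraph G).edgeSet.ncard
    have hlog : 1 ≤ Real.logb 2 n := by
      rw [Real.le_logb_iff_rpow_le one_lt_two (by positivity)]
      exact_mod_cast hn
    have hL : ((L + 1 : ℕ) : ℝ) ≤ 3 * Real.logb 2 n := by
      have := Real.natLog_le_logb n 2
      simp only [L]
      push_cast at this ⊢
      linarith
    have hmul : 200 * I.n + 100 * S + 70 * D + 200 ≤ 500 * (f + n) := by
      change D ≤ S + n at hD
      change S = 2 * f at hS
      change 200 * n + 100 * S + 70 * D + 200 ≤ _
      omega
    have hnat : (TBUDS.run I (n + L + 1)).time ≤ (L + 1) * (500 * (f + n)) :=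
      (htime.trans (by rw [show (TBUDS.State.init ℝ).time = 0 from rfl, zero_add])).trans
        (Nat.mul_le_mul_left _ hmul)
    calc ((TBUDS.run I (n + L + 1)).time : ℝ) ≤ ((L + 1 : ℕ) : ℝ) * (500 * (f + n)) := by
          exact_mod_cast hnat
      _ ≤ (3 * Real.logb 2 n) * (500 * (f + n)) := by gcongr
      _ ≤ 2000 * (f + n) * Real.logb 2 n := by
          have : 0 ≤ ((f : ℝ) + n) * Real.logb 2 n := by positivity
          linarith
  · have : ((TBUDS.run I (n + L + 1)).space : ℝ) ≤ 24 * n := by exact_mod_cast hinv.space_le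
    have : (0 : ℝ) ≤ n := Nat.cast_nonneg n
    linarith
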